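/- Consider the problem of maximizing a non-negative (not necessarily monotone) submodular function $f\colon 2^{\mathcal N}\to\mathbb R_{\ge 0}$ on a finite ground set $\mathcal N$ of size $n$ over all sets $S\subseteq\mathcal N$ with $|S|\le k$, where $k\ge 1$. The elements of $\mathcal N$ arrive one by one in an arbitrary order, each exactly once, and $f$ is accessed through a value oracle that may be queried on sets of currently stored elements. A (possibly randomized) streaming algorithm is a fixed random access machine program, which gets $k$ as input and does not depend on $\mathcal N$, $f$ or $k$. It is a $\rho$-approximation algorithm if it always stops with a feasible set $S$ and $\rho\cdot\mathbb E[f(S)]\ge f(S')$ for every feasible $S'$. It is semi-streaming if it always uses at most $O(k\cdot\mathrm{polylog}(k,n))$ space, where storing an element or a real number takes $O(1)$ space (plus the bit length of the address of the cell) and a natural number takes its bit length. There are constants $C$ and $d$ such that, for every constant $\varepsilon\in(0,1]$, there is a semi-streaming $(3+\varepsilon)$-approximation algorithm for this problem which at any moment stores at most $C\,k\,\varepsilon^{-2}\log(k+1)$ elements, and which runs for at most $h(k,\varepsilon)\cdot(n+1)^d$ steps, for some function $h$ (which need not be polynomial). -/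

import Mathlib

open MeasureTheory

noncomputable section

namespace Streaming

/-! ### Expressions and programs

The machine is a random access machine with three memories: natural numbers, real numbers, and
elements of the ground set. Elements are opaque: they can only be copied, erased, put into a set
buffer that is handed to the value oracle, and output. A program is a fixed finite piece of code;
in particular it depends neither on the ground set, nor on the objective, nor on `k`. -/

/-- Expressions with a value in `ℕ`; `load a` is the content of the cell with address `a`. -/
inductive NExp : Type
  | const (n : ℕ)
  | load (a : NExp)
  | add (x y : NExp)
  | sub (x y : NExp)
  | mul (x y : NExp)
  | div (x y : NExp)
  | mod (x y : NExp)

/-- Expressions with a value in `ℝ`. The only constants of a program are natural numbers. -/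
inductive RExp : Type
  | ofNat (n : NExp)
  | load (a : NExp)
  | add (x y : RExp)
  | sub (x y : RExp)
  | mul (x y : RExp)
  | div (x y : RExp)

/-- Tests. `occupied a` asks whether the element cell with address `a` holds an element. -/
inductive Test : Type
  | natEq (x y : NExp)
  | natLt (x y : NExp)
  | realLe (x y : RExp)
  | occupied (a : NExp)
  | not (b : Test)
  | and (b c : Test)

/-- Programs. -/
inductive Prog : Type
  | skip
  /-- write the value of `e` into the natural number cell `a` -/
  | setNat (a : NExp) (e : NExp)
  /-- write the value of `e` into the real number cell `a` -/
  | setReal (a : NExp) (e : RExp)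
  /-- copy the content of the element cell `src` to the element cell `dst` -/
  | copyElem (dst src : NExp)
  /-- erase the element cell `a` -/
  | eraseElem (a : NExp)
  /-- empty the set buffer -/
  | clearBuf
  /-- add the element in the element cell `a` (if there is one) to the set buffer -/
  | addBuf (a : NExp)
  /-- value oracle query: write `f (buffer)` into the real number cell `a` -/
  | query (a : NExp)
  /-- toss a fair coin and write the result, `0` or `1`, into the natural number cell `a` -/
  | flip (a : NExp)
  | seq (p q : Prog)
  | ite (b : Test) (p q : Prog)
  | loop (b : Test) (p : Prog)

/-- A streaming algorithm: the code run before the stream starts, the code run upon each arrival of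
an element, and the code run when the stream has ended. The final set buffer is the output. -/
structure Alg : Type where
  init : Prog
  arrival : Prog
  finish : Prog

/-! ### The machine -/

/-- A configuration of the machine. The memories are finitely supported; a number cell holds `0` and
an element cell is empty (the `0` of `WithZero V`) unless something else was written there. -/
structure Config (V : Type) : Type where
  nat : ℕ →₀ ℕ
  real : ℕ →₀ ℝ
  elem : ℕ →₀ WithZero V
  /-- the set buffer -/
  buf : Finset V
  /-- The control stack, a list of subprograms of the three programs of the algorithm. Its length is
  bounded by the nesting depth of these, so this is a finite control. -/
  todo : List Prog
  /-- the part of the stream that has not arrived yet -/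
  input : List V
  /-- whether the end of the stream was already noticed -/
  ended : Bool
  /-- the results of the future coin tosses -/
  coins : ℕ → Bool

variable {V : Type}

def NExp.eval (c : Config V) : NExp → ℕ
  | .const n => n
  | .load a => c.nat (a.eval c)
  | .add x y => x.eval c + y.eval c
  | .sub x y => x.eval c - y.eval c
  | .mul x y => x.eval c * y.eval c
  | .div x y => x.eval c / y.eval c
  | .mod x y => x.eval c % y.eval c

def RExp.eval (c : Config V) : RExp → ℝ
  | .ofNat n => (n.eval c : ℝ)
  | .load a => c.real (a.eval c)
  | .add x y => x.eval c + y.eval c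
  | .sub x y => x.eval c - y.eval c
  | .mul x y => x.eval c * y.eval c
  | .div x y => x.eval c / y.eval c

def Test.eval (c : Config V) : Test → Prop
  | .natEq x y => x.eval c = y.eval c
  | .natLt x y => x.eval c < y.eval c
  | .realLe x y => x.eval c ≤ y.eval c
  | .occupied a => c.elem (a.eval c) ≠ 0
  | .not b => ¬ b.eval c
  | .and b b' => b.eval c ∧ b'.eval c

open Classical in
/-- The effect of starting to execute the program `p`, with the rest of the control stack already in
`c.todo`. Here `f` is the objective, accessed only by `query`. -/
def Prog.exec (f : Finset V → ℝ) (c : Config V) : Prog → Config V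
  | .skip => c
  | .setNat a e => { c with nat := c.nat.update (a.eval c) (e.eval c) }
  | .setReal a e => { c with real := c.real.update (a.eval c) (e.eval c) }
  | .copyElem dst src => { c with elem := c.elem.update (dst.eval c) (c.elem (src.eval c)) }
  | .eraseElem a => { c with elem := c.elem.update (a.eval c) 0 }
  | .clearBuf => { c with buf := ∅ }
  | .addBuf a =>
      { c with buf := WithZero.recZeroCoe c.buf (fun v => insert v c.buf) (c.elem (a.eval c)) }
  | .query a => { c with real := c.real.update (a.eval c) (f c.buf) }
  | .flip a =>
      { c with
        nat := c.nat.update (a.eval c) (c.coins 0).toNat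
        coins := fun i => c.coins (i + 1) }
  | .seq p q => { c with todo := p :: q :: c.todo }
  | .ite b p q => { c with todo := (if b.eval c then p else q) :: c.todo }
  | .loop b p => if b.eval c then { c with todo := p :: .loop b p :: c.todo } else c

/-- One step of the machine. When there is nothing left to do for the current element, the next
element arrives in the element cell `0` (overwriting it); after the last one, `finish` is run. -/
def Alg.step (A : Alg) (f : Finset V → ℝ) (c : Config V) : Config V :=
  match c.todo, c.input with
  | p :: rest, _ => p.exec f { c with todo := rest }
  | [], v :: vs =>
      { c with elem := c.elem.update 0 (v : WithZero V), input := vs, todo := [A.arrival] }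
  | [], [] => if c.ended then c else { c with ended := true, todo := [A.finish] }

/-- The initial configuration: all memory is empty, except that the natural number cell `0` holds
the cardinality bound `k`. -/
def Alg.start (A : Alg) (k : ℕ) (stream : List V) (ω : ℕ → Bool) : Config V where
  nat := Finsupp.single 0 k
  real := 0
  elem := 0
  buf := ∅
  todo := [A.init]
  input := stream
  ended := false
  coins := ω

/-- The configuration after `t` steps. -/
def Alg.run (A : Alg) (f : Finset V → ℝ) (k : ℕ) (stream : List V) (ω : ℕ → Bool) (t : ℕ) :
    Config V :=
  (A.step f)^[t] (A.start k stream ω)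

/-- A configuration in which the machine has stopped. -/
def Config.Halted (c : Config V) : Prop :=
  c.todo = [] ∧ c.input = [] ∧ c.ended = true

/-- The number of elements of the ground set stored in a configuration. -/
def Config.stored (c : Config V) : ℕ :=
  c.elem.support.card + c.buf.card

/-- The space used in a configuration. A cell in use costs the bit length of its address, plus the
bit length of its content if that is a natural number, or `1` if it is a real number (such as a
value of the oracle) or an element. A further `1` is paid for each element of the set buffer. -/
def Config.space (c : Config V) : ℕ :=
  (∑ a ∈ c.nat.support, (Nat.size a + Nat.size (c.nat a)))
    + (∑ a ∈ c.real.support, (Nat.size a + 1))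
    + (∑ a ∈ c.elem.support, (Nat.size a + 1))
    + c.buf.card

open Classical in
/-- The output: the content of the set buffer when the machine stops (and `∅` if it never does). -/
def Alg.output (A : Alg) (f : Finset V → ℝ) (k : ℕ) (stream : List V) (ω : ℕ → Bool) : Finset V :=
  if h : ∃ t, (A.run f k stream ω t).Halted then (A.run f k stream ω (Nat.find h)).buf else ∅

/-- The law of an infinite sequence of independent fair coin tosses. -/
def coinLaw : Measure (ℕ → Bool) :=
  Measure.infinitePi fun _ => (PMF.uniformOfFintype Bool).toMeasure

/-! ### The problem and the guarantees -/

/-- Submodularity of a set function. -/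
def IsSubmodular [DecidableEq V] (f : Finset V → ℝ) : Prop :=
  ∀ A B : Finset V, A ⊆ B → ∀ u, u ∉ B → f (insert u B) - f B ≤ f (insert u A) - f A

/-- An instance of the problem: a non-negative submodular objective on a finite ground set, a
cardinality bound `k ≥ 1`, and an arrival order in which each element appears exactly once. -/
structure IsInstance [Fintype V] [DecidableEq V] (f : Finset V → ℝ) (k : ℕ) (stream : List V) :
    Prop where
  nonneg : ∀ S, 0 ≤ f S
  submodular : IsSubmodular f
  one_le : 1 ≤ k
  nodup : stream.Nodup
  complete : ∀ v, v ∈ stream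

/-- `A` is a `ρ`-approximation algorithm: on every instance it always stops with a feasible set, and
the expected value of this set is at least a `1 / ρ` fraction of the value of any feasible set. -/
def Alg.IsApproximation (A : Alg) (ρ : ℝ) : Prop :=
  ∀ (V : Type) [Fintype V] [DecidableEq V] (f : Finset V → ℝ) (k : ℕ) (stream : List V),
    IsInstance f k stream →
      (∀ ω, (∃ t, (A.run f k stream ω t).Halted) ∧ (A.output f k stream ω).card ≤ k) ∧
      Integrable (fun ω => f (A.output f k stream ω)) coinLaw ∧
      ∀ S : Finset V, S.card ≤ k → f S ≤ ρ * ∫ ω, f (A.output f k stream ω) ∂coinLaw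

/-- At every moment of every run, `A` stores at most `B k` elements. -/
def Alg.StoresAtMost (A : Alg) (B : ℕ → ℝ) : Prop :=
  ∀ (V : Type) [Fintype V] [DecidableEq V] (f : Finset V → ℝ) (k : ℕ) (stream : List V),
    IsInstance f k stream →
      ∀ ω t, ((A.run f k stream ω t).stored : ℝ) ≤ B k

/-- `A` is semi-streaming: with `n` the size of the ground set, it always uses at most
`O(k * polylog (k, n))` space. -/
def Alg.IsSemiStreaming (A : Alg) : Prop :=
  ∃ (C : ℝ) (e : ℕ),
    ∀ (V : Type) [Fintype V] [DecidableEq V] (f : Finset V → ℝ) (k : ℕ) (stream : List V),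
      IsInstance f k stream →
        ∀ ω t, ((A.run f k stream ω t).space : ℝ) ≤
          C * k * Real.log (k + Fintype.card V + 1) ^ e

/-- Every run of `A` stops after at most `T k n` steps, with `n` the size of the ground set. -/
def Alg.RunsInTime (A : Alg) (T : ℕ → ℕ → ℝ) : Prop :=
  ∀ (V : Type) [Fintype V] [DecidableEq V] (f : Finset V → ℝ) (k : ℕ) (stream : List V),
    IsInstance f k stream →
      ∀ ω, ∃ t : ℕ, (t : ℝ) ≤ T k (Fintype.card V) ∧ (A.run f k stream ω t).Halted

end Streaming

end

/-!
The algorithm is a deterministic sieve with exhaustive post-processing; it never tosses a coin.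

Let `q = 1 + 1 / N` and let `M` be the largest singleton value seen so far. The algorithm keeps
`L = O(N log (k + 1))` slots, whose thresholds `T` form a geometric progression with ratio `q`, up to powers
of `W = q ^ L ≥ 8 k`, in the window `(M / W, M]`. A slot has `m` disjoint bins of capacity `k`; an
arriving element goes to the first bin that is not full and with respect to which its marginal is at
least `T`. When `M` grows, the slots whose thresholds leave the window are emptied and restarted with
thresholds above the old `M`: they would have rejected all the earlier elements
(`SlotInv.restart`). At the end a best set of at most `k` stored elements is found by exhaustive
search; call its value `a`.

Let `O` be an optimal set. Since `M ≤ f O ≤ k M`, some threshold `T` has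
`f O ≤ (3 + ε) k T ≤ (1 + ε / 2) f O` (`ThresholdInv.exists_threshold`). If a bin of its slot is full,
it has value at least `k T`. Otherwise let `U` be the union of the bins. Each element of `O` outside
`U` was rejected by each bin `B`, so submodularity gives
`f (O ∪ B) ≤ f B + f (O ∩ U) + k T ≤ 2 a + k T`. As the bins are disjoint, the average of `f (O ∪ B)`
over them is at least `(1 - 1 / m) f O` (`IsSubmodular.sub_one_mul_le_sum`). Both cases yield
`f O ≤ (3 + ε) a` (`SlotInv.le_mul`).

The programs are verified with a Hoare logic (`Triple`) in which a judgement bounds the number of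
steps, states the postcondition, and asserts that the memory bounds `Within` hold at every moment. The
final memory in a judgement is chosen before the coins, so that the output does not depend on them.
`exists_final` collects what this gives for a complete run; the bounds for space and the number of
stored elements follow from `Within`, since there are `L m k` element cells besides the arrival cell.
-/

open MeasureTheory

noncomputable section

namespace Streaming

variable {V : Type}

/-! ### A Hoare logic for the machine -/

/-- The memory of a configuration, as plain functions, without control stack, input and coins. -/
structure Mem (V : Type) where
  nat : ℕ → ℕ
  real : ℕ → ℝ
  elem : ℕ → WithZero V
  buf : Finset V

/-- The memory of a configuration. -/
def Config.mem (c : Config V) : Mem V := ⟨c.nat, c.real, c.elem, c.buf⟩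

/-- Evaluation of an expression in a memory. -/
def NExp.ev (μ : Mem V) : NExp → ℕ
  | .const n => n
  | .load a => μ.nat (a.ev μ)
  | .add x y => x.ev μ + y.ev μ
  | .sub x y => x.ev μ - y.ev μ
  | .mul x y => x.ev μ * y.ev μ
  | .div x y => x.ev μ / y.ev μ
  | .mod x y => x.ev μ % y.ev μ

/-- Evaluation of an expression in a memory. -/
def RExp.ev (μ : Mem V) : RExp → ℝ
  | .ofNat n => (n.ev μ : ℝ)
  | .load a => μ.real (a.ev μ)
  | .add x y => x.ev μ + y.ev μ
  | .sub x y => x.ev μ - y.ev μ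
  | .mul x y => x.ev μ * y.ev μ
  | .div x y => x.ev μ / y.ev μ

/-- Evaluation of a test in a memory. -/
def Test.ev (μ : Mem V) : Test → Prop
  | .natEq x y => x.ev μ = y.ev μ
  | .natLt x y => x.ev μ < y.ev μ
  | .realLe x y => x.ev μ ≤ y.ev μ
  | .occupied a => μ.elem (a.ev μ) ≠ 0
  | .not b => ¬ b.ev μ
  | .and b c => b.ev μ ∧ c.ev μ

theorem NExp.eval_eq (c : Config V) (e : NExp) : e.eval c = e.ev c.mem := by
  induction e with
  | const n => rfl
  | load a ih => simp only [NExp.eval, NExp.ev, ih]; rfl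
  | _ => simp only [NExp.eval, NExp.ev, *]

theorem RExp.eval_eq (c : Config V) (e : RExp) : e.eval c = e.ev c.mem := by
  induction e with
  | ofNat n => simp only [RExp.eval, RExp.ev, NExp.eval_eq]
  | load a => simp only [RExp.eval, RExp.ev, NExp.eval_eq]; rfl
  | _ => simp only [RExp.eval, RExp.ev, *]

theorem Test.eval_iff (c : Config V) (b : Test) : b.eval c ↔ b.ev c.mem := by
  induction b with
  | natEq x y => simp only [Test.eval, Test.ev, NExp.eval_eq]
  | natLt x y => simp only [Test.eval, Test.ev, NExp.eval_eq]
  | realLe x y => simp only [Test.eval, Test.ev, RExp.eval_eq]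
  | occupied a => simp only [Test.eval, Test.ev, NExp.eval_eq]; rfl
  | _ => simp only [Test.eval, Test.ev, *]

/-- The content of an element cell, as a set with at most one element. -/
def cellSet (w : WithZero V) : Finset V := WithZero.recZeroCoe ∅ (fun v => {v}) w

@[simp] theorem cellSet_zero : cellSet (0 : WithZero V) = ∅ := rfl

@[simp] theorem cellSet_coe (v : V) : cellSet (v : WithZero V) = {v} := rfl

theorem card_cellSet_le (w : WithZero V) : (cellSet w).card ≤ 1 := by
  induction w using WithZero.recZeroCoe <;> simp

theorem mem_cellSet {w : WithZero V} {v : V} : v ∈ cellSet w ↔ w = v := by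
  induction w using WithZero.recZeroCoe with
  | zero => simp
  | coe a => simp [eq_comm]

/-- What a configuration determines, apart from the future coin tosses. -/
def Config.visible (c : Config V) : Mem V × List Prog × List V × Bool :=
  (c.mem, c.todo, c.input, c.ended)

/-- Every configuration that looks like `σ` gets in `t` steps to one that looks like `σ'`, whatever
the coins, and all the memories on the way satisfy `I`. -/
def Steps (A : Alg) (f : Finset V → ℝ) (I : Mem V → Prop)
    (σ : Mem V × List Prog × List V × Bool) (t : ℕ) (σ' : Mem V × List Prog × List V × Bool) :
    Prop :=
  ∀ c : Config V, c.visible = σ →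
    ((A.step f)^[t] c).visible = σ' ∧ ∀ s ≤ t, I ((A.step f)^[s] c).mem

section Steps

variable {A : Alg} {f : Finset V → ℝ} {I : Mem V → Prop}

theorem Steps.trans {σ σ' σ'' : Mem V × List Prog × List V × Bool} {t t' : ℕ}
    (h : Steps A f I σ t σ') (h' : Steps A f I σ' t' σ'') : Steps A f I σ (t + t') σ'' := by
  intro c hc
  obtain ⟨h1, h2⟩ := h c hc
  obtain ⟨h3, h4⟩ := h' _ h1
  rw [← Function.iterate_add_apply, add_comm] at h3
  refine ⟨h3, fun s hs => ?_⟩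
  rcases le_total s t with hst | hst
  · exact h2 s hst
  · have := h4 (s - t) (by omega)
    rwa [← Function.iterate_add_apply, Nat.sub_add_cancel hst] at this

theorem Steps.refl {μ : Mem V} {x : List Prog × List V × Bool} (h : I μ) :
    Steps A f I (μ, x) 0 (μ, x) := by
  intro c hc
  refine ⟨hc, fun s hs => ?_⟩
  obtain rfl : s = 0 := by omega
  have : c.mem = μ := congrArg Prod.fst hc
  simpa [this] using h

theorem Steps.single {μ μ' : Mem V} {x y : List Prog × List V × Bool} (h : I μ) (h' : I μ')
    (hs : ∀ c : Config V, c.visible = (μ, x) → (A.step f c).visible = (μ', y)) :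
    Steps A f I (μ, x) 1 (μ', y) := by
  intro c hc
  have h1 := hs c hc
  refine ⟨h1, fun s hs => ?_⟩
  have e0 : c.mem = μ := congrArg Prod.fst hc
  have e1 : (A.step f c).mem = μ' := congrArg Prod.fst h1
  interval_cases s
  · simpa [e0] using h
  · simpa [e1] using h'

end Steps

/-- Started in the memory `μ`, the program `p` ends within `T` steps in a memory with `Q`, which does
not depend on the coins, and all the memories on the way satisfy `I`. -/
def Triple (f : Finset V → ℝ) (I : Mem V → Prop) (p : Prog) (μ : Mem V) (T : ℕ)
    (Q : Mem V → Prop) : Prop :=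
  ∃ t ≤ T, ∃ μ', I μ' ∧ Q μ' ∧ ∀ A rest inp e, Steps A f I (μ, p :: rest, inp, e) t (μ', rest, inp, e)

section Triple

variable {f : Finset V → ℝ} {I : Mem V → Prop} {p q : Prog} {b : Test} {μ : Mem V} {T T' : ℕ}
  {Q R : Mem V → Prop}

theorem Triple.mono (h : Triple f I p μ T R) (hT : T ≤ T') (hQ : ∀ μ', I μ' → R μ' → Q μ') :
    Triple f I p μ T' Q := by
  obtain ⟨t, ht, μ', hI, hR, hs⟩ := h
  exact ⟨t, ht.trans hT, μ', hI, hQ _ hI hR, hs⟩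

theorem Triple.leaf (h : Triple f I p μ 1 Q) (hT : 0 < T) : Triple f I p μ T Q :=
  h.mono hT fun _ _ h => h

theorem Triple.seq (hI : I μ) (hp : Triple f I p μ T R)
    (hT : T < T') (hq : ∀ μ', I μ' → R μ' → Triple f I q μ' (T' - T - 1) Q) :
    Triple f I (.seq p q) μ T' Q := by
  obtain ⟨t, ht, μ', hI', hR, hs⟩ := hp
  obtain ⟨t', ht', μ'', hI'', hR', hs'⟩ := hq _ hI' hR
  refine ⟨1 + (t + t'), by omega, μ'', hI'', hR', fun A rest inp e => ?_⟩
  refine Steps.trans (Steps.single (μ' := μ) (y := (p :: q :: rest, inp, e)) hI hI ?_)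
    (Steps.trans (hs A _ _ _) (hs' A _ _ _))
  rintro ⟨n, r, el, bf, td, ip, en, co⟩ hc
  simp only [Config.visible, Config.mem, Prod.mk.injEq] at hc
  obtain ⟨rfl, rfl, rfl, rfl⟩ := hc
  rfl

/-- The rule for a sequence that starts with an instruction whose effect is known exactly. -/
theorem Triple.step {μ' : Mem V} (hI : I μ) (hp : Triple f I p μ 1 (· = μ')) (hT : 1 < T)
    (hq : I μ' → Triple f I q μ' (T - 2) Q) : Triple f I (.seq p q) μ T Q :=
  Triple.seq hI hp hT fun _ h e => e ▸ hq (e ▸ h)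

theorem Triple.ite (hI : I μ) (hT : 0 < T) (hp : b.ev μ → Triple f I p μ (T - 1) Q)
    (hq : ¬ b.ev μ → Triple f I q μ (T - 1) Q) : Triple f I (.ite b p q) μ T Q := by
  by_cases hb : b.ev μ
  · obtain ⟨t, ht, μ', hI', hR, hs⟩ := hp hb
    refine ⟨1 + t, by omega, μ', hI', hR, fun A rest inp e => ?_⟩
    refine Steps.trans (Steps.single (μ' := μ) (y := (p :: rest, inp, e)) hI hI ?_) (hs A _ _ _)
    rintro ⟨n, r, el, bf, td, ip, en, co⟩ hc
    simp only [Config.visible, Config.mem, Prod.mk.injEq] at hc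
    obtain ⟨rfl, rfl, rfl, rfl⟩ := hc
    have := (Test.eval_iff (⟨n, r, el, bf, rest, ip, en, co⟩ : Config V) b).2 hb
    simp [Alg.step, Prog.exec, this, Config.visible, Config.mem]
  · obtain ⟨t, ht, μ', hI', hR, hs⟩ := hq hb
    refine ⟨1 + t, by omega, μ', hI', hR, fun A rest inp e => ?_⟩
    refine Steps.trans (Steps.single (μ' := μ) (y := (q :: rest, inp, e)) hI hI ?_) (hs A _ _ _)
    rintro ⟨n, r, el, bf, td, ip, en, co⟩ hc
    simp only [Config.visible, Config.mem, Prod.mk.injEq] at hc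
    obtain ⟨rfl, rfl, rfl, rfl⟩ := hc
    have := mt (Test.eval_iff (⟨n, r, el, bf, rest, ip, en, co⟩ : Config V) b).1 hb
    simp [Alg.step, Prog.exec, this, Config.visible, Config.mem]

theorem Triple.loop_false (hI : I μ) (hb : ¬ b.ev μ) (hQ : Q μ) :
    Triple f I (.loop b p) μ 1 Q := by
  refine ⟨1, le_rfl, μ, hI, hQ, fun A rest inp e => Steps.single hI hI ?_⟩
  rintro ⟨n, r, el, bf, td, ip, en, co⟩ hc
  simp only [Config.visible, Config.mem, Prod.mk.injEq] at hc
  obtain ⟨rfl, rfl, rfl, rfl⟩ := hc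
  have := mt (Test.eval_iff (⟨n, r, el, bf, rest, ip, en, co⟩ : Config V) b).1 hb
  simp [Alg.step, Prog.exec, this, Config.visible, Config.mem]

theorem Triple.loop_true (hI : I μ) (hb : b.ev μ) (hp : Triple f I p μ T R)
    (hq : ∀ μ', I μ' → R μ' → Triple f I (.loop b p) μ' T' Q) :
    Triple f I (.loop b p) μ (T + T' + 1) Q := by
  obtain ⟨t, ht, μ', hI', hR, hs⟩ := hp
  obtain ⟨t', ht', μ'', hI'', hR', hs'⟩ := hq _ hI' hR
  refine ⟨1 + (t + t'), by omega, μ'', hI'', hR', fun A rest inp e => ?_⟩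
  refine Steps.trans (Steps.single (μ' := μ) (y := (p :: .loop b p :: rest, inp, e)) hI hI ?_)
    (Steps.trans (hs A _ _ _) (hs' A _ _ _))
  rintro ⟨n, r, el, bf, td, ip, en, co⟩ hc
  simp only [Config.visible, Config.mem, Prod.mk.injEq] at hc
  obtain ⟨rfl, rfl, rfl, rfl⟩ := hc
  have := (Test.eval_iff (⟨n, r, el, bf, rest, ip, en, co⟩ : Config V) b).2 hb
  simp [Alg.step, Prog.exec, this, Config.visible, Config.mem]

/-- The rule for a loop that makes exactly `n` rounds; `J i` is what holds after `i` rounds. -/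
theorem Triple.forLoop (n : ℕ) (J : ℕ → Mem V → Prop)
    (hb : ∀ i μ, i ≤ n → J i μ → (b.ev μ ↔ i < n))
    (hp : ∀ i < n, ∀ μ, I μ → J i μ → Triple f I p μ T (J (i + 1)))
    (hI : I μ) (h0 : J 0 μ) : Triple f I (.loop b p) μ (n * (T + 1) + 1) (J n) := by
  have key : ∀ d i μ, i + d = n → I μ → J i μ →
      Triple f I (.loop b p) μ (d * (T + 1) + 1) (J n) := by
    intro d
    induction d with
    | zero =>
      intro i μ hi hI hJ
      obtain rfl : i = n := by omega
      have := hb i μ le_rfl hJ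
      refine (Triple.loop_false hI (by simp [this]) hJ).mono (by omega) fun _ _ h => h
    | succ d ih =>
      intro i μ hi hI hJ
      refine (Triple.loop_true hI ((hb i μ (by omega) hJ).2 (by omega)) (hp i (by omega) μ hI hJ)
        fun μ' hI' hJ' => ih (i + 1) μ' (by omega) hI' hJ').mono ?_ fun _ _ h => h
      rw [Nat.succ_mul]; omega
  exact key n 0 μ (by omega) hI h0

/-- The rule for an instruction that changes the memory and not the control stack. -/
theorem Triple.atom {μ' : Mem V} (hI : I μ) (hQ : Q μ') (hI' : I μ')
    (h : ∀ c : Config V, c.mem = μ → ((p.exec f c).mem, (p.exec f c).todo, (p.exec f c).input,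
      (p.exec f c).ended) = (μ', c.todo, c.input, c.ended)) : Triple f I p μ 1 Q := by
  refine ⟨1, le_rfl, μ', hI', hQ, fun A rest inp e => Steps.single hI hI' ?_⟩
  rintro ⟨n, r, el, bf, td, ip, en, co⟩ hc
  simp only [Config.visible, Config.mem, Prod.mk.injEq] at hc
  obtain ⟨rfl, rfl, rfl, rfl⟩ := hc
  exact h ⟨n, r, el, bf, rest, ip, en, co⟩ rfl

/-- Bounds for the memory that an algorithm uses. -/
structure Limits where
  natCells : ℕ
  natValue : ℕ
  realCells : ℕ
  elemCells : ℕ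
  bufSize : ℕ

/-- The memory `μ` respects the bounds `w`. -/
structure Within (w : Limits) (μ : Mem V) : Prop where
  nat_zero : ∀ a, w.natCells ≤ a → μ.nat a = 0
  nat_le : ∀ a, μ.nat a ≤ w.natValue
  real_zero : ∀ a, w.realCells ≤ a → μ.real a = 0
  elem_zero : ∀ a, w.elemCells ≤ a → μ.elem a = 0
  buf_le : μ.buf.card ≤ w.bufSize

variable {w : Limits}

theorem Triple.skip (hI : I μ) (hQ : Q μ) : Triple f I .skip μ 1 Q := by
  refine Triple.atom hI hQ hI fun c hc => ?_
  simp [Prog.exec, hc]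

theorem Triple.setNat {a e : NExp} (hI : Within w μ) (ha : a.ev μ < w.natCells)
    (he : e.ev μ ≤ w.natValue)
    (hQ : Q { μ with nat := Function.update μ.nat (a.ev μ) (e.ev μ) }) :
    Triple f (Within w) (.setNat a e) μ 1 Q := by
  refine Triple.atom hI hQ ⟨fun b hb => ?_, fun b => ?_, hI.real_zero, hI.elem_zero, hI.buf_le⟩
    fun c hc => ?_
  · exact (Function.update_of_ne (by omega) _ _).trans (hI.nat_zero b hb)
  · dsimp only
    rw [Function.update_apply]; split_ifs
    exacts [he, hI.nat_le b]
  · subst hc; simp [Prog.exec, Config.mem, NExp.eval_eq]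

theorem Triple.setReal {a : NExp} {e : RExp} (hI : Within w μ) (ha : a.ev μ < w.realCells)
    (hQ : Q { μ with real := Function.update μ.real (a.ev μ) (e.ev μ) }) :
    Triple f (Within w) (.setReal a e) μ 1 Q := by
  refine Triple.atom hI hQ ⟨hI.nat_zero, hI.nat_le, fun b hb => ?_, hI.elem_zero, hI.buf_le⟩
    fun c hc => ?_
  · exact (Function.update_of_ne (by omega) _ _).trans (hI.real_zero b hb)
  · subst hc; simp [Prog.exec, Config.mem, NExp.eval_eq, RExp.eval_eq]

theorem Triple.query {a : NExp} (hI : Within w μ) (ha : a.ev μ < w.realCells)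
    (hQ : Q { μ with real := Function.update μ.real (a.ev μ) (f μ.buf) }) :
    Triple f (Within w) (.query a) μ 1 Q := by
  refine Triple.atom hI hQ ⟨hI.nat_zero, hI.nat_le, fun b hb => ?_, hI.elem_zero, hI.buf_le⟩
    fun c hc => ?_
  · exact (Function.update_of_ne (by omega) _ _).trans (hI.real_zero b hb)
  · subst hc; simp [Prog.exec, Config.mem, NExp.eval_eq]

theorem Triple.copyElem {a e : NExp} (hI : Within w μ) (ha : a.ev μ < w.elemCells)
    (hQ : Q { μ with elem := Function.update μ.elem (a.ev μ) (μ.elem (e.ev μ)) }) :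
    Triple f (Within w) (.copyElem a e) μ 1 Q := by
  refine Triple.atom hI hQ ⟨hI.nat_zero, hI.nat_le, hI.real_zero, fun b hb => ?_, hI.buf_le⟩
    fun c hc => ?_
  · exact (Function.update_of_ne (by omega) _ _).trans (hI.elem_zero b hb)
  · subst hc; simp [Prog.exec, Config.mem, NExp.eval_eq]

theorem Triple.eraseElem {a : NExp} (hI : Within w μ)
    (hQ : Q { μ with elem := Function.update μ.elem (a.ev μ) 0 }) :
    Triple f (Within w) (.eraseElem a) μ 1 Q := by
  refine Triple.atom hI hQ ⟨hI.nat_zero, hI.nat_le, hI.real_zero, fun b hb => ?_, hI.buf_le⟩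
    fun c hc => ?_
  · dsimp only
    rw [Function.update_apply]; split_ifs
    exacts [rfl, hI.elem_zero b hb]
  · subst hc; simp [Prog.exec, Config.mem, NExp.eval_eq]

theorem Triple.clearBuf (hI : Within w μ) (hQ : Q { μ with buf := ∅ }) :
    Triple f (Within w) .clearBuf μ 1 Q := by
  refine Triple.atom hI hQ ⟨hI.nat_zero, hI.nat_le, hI.real_zero, hI.elem_zero, by simp⟩
    fun c hc => ?_
  subst hc; simp [Prog.exec, Config.mem]

open Classical in
theorem Triple.addBuf {a : NExp} (hI : Within w μ) (hb : μ.buf.card < w.bufSize)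
    (hQ : Q { μ with buf := μ.buf ∪ cellSet (μ.elem (a.ev μ)) }) :
    Triple f (Within w) (.addBuf a) μ 1 Q := by
  refine Triple.atom hI hQ ⟨hI.nat_zero, hI.nat_le, hI.real_zero, hI.elem_zero, ?_⟩
    fun c hc => ?_
  · have := Finset.card_union_le μ.buf (cellSet (μ.elem (a.ev μ)))
    have := card_cellSet_le (μ.elem (a.ev μ))
    change (μ.buf ∪ cellSet (μ.elem (a.ev μ))).card ≤ _
    omega
  · subst hc
    simp only [Prog.exec, Config.mem, NExp.eval_eq]
    generalize c.elem _ = x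
    induction x using WithZero.recZeroCoe with
    | zero => simp
    | coe v => simp [Finset.union_comm _ {v}]

end Triple

/-! ### Submodular functions and slots -/

section Submodular

variable [DecidableEq V] {f : Finset V → ℝ}

theorem IsSubmodular.union_sub_le (hf : IsSubmodular f) {A B : Finset V} (hAB : A ⊆ B)
    {X : Finset V} (hX : Disjoint X B) : f (B ∪ X) - f B ≤ f (A ∪ X) - f A := by
  induction X using Finset.induction_on with
  | empty => simp
  | insert x X hx ih =>
    rw [Finset.disjoint_insert_left] at hX
    have h1 := ih hX.2
    have h2 := hf (A ∪ X) (B ∪ X) (Finset.union_subset_union_left hAB) x (by simp [hX.1, hx])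
    rw [Finset.union_insert, Finset.union_insert]
    linarith

theorem IsSubmodular.union_add_inter_le (hf : IsSubmodular f) (A B : Finset V) :
    f (A ∪ B) + f (A ∩ B) ≤ f A + f B := by
  have h := hf.union_sub_le (A := A ∩ B) (B := B) (X := A \ B) Finset.inter_subset_right
    Finset.sdiff_disjoint
  have e1 : B ∪ A \ B = A ∪ B := by ext; simp; tauto
  have e2 : A ∩ B ∪ A \ B = A := by ext; simp; tauto
  rw [e1, e2] at h
  linarith

theorem IsSubmodular.union_le_add (hf : IsSubmodular f) (h0 : ∀ S, 0 ≤ f S) (A B : Finset V) :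
    f (A ∪ B) ≤ f A + f B := by
  linarith [hf.union_add_inter_le A B, h0 (A ∩ B)]

/-- Disjoint sets cannot all harm `O`: on average, adding one of them to `O` keeps all but a `1 / m`
fraction of the value. -/
theorem IsSubmodular.sub_one_mul_le_sum (hf : IsSubmodular f) (h0 : ∀ S, 0 ≤ f S) (O : Finset V)
    (B : ℕ → Finset V) (m : ℕ)
    (hB : ∀ i < m, ∀ i' < m, i ≠ i' → Disjoint (B i) (B i')) :
    ((m : ℝ) - 1) * f O ≤ ∑ i ∈ Finset.range m, f (O ∪ B i) := by
  have key : ∀ n ≤ m, ((n : ℝ) - 1) * f O + f (O ∪ (Finset.range n).biUnion B) ≤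
      ∑ i ∈ Finset.range n, f (O ∪ B i) := by
    intro n
    induction n with
    | zero => simp
    | succ n ih =>
      intro hn
      have h1 := ih (by omega)
      have h2 := hf.union_add_inter_le (O ∪ (Finset.range n).biUnion B) (O ∪ B n)
      have e1 : (O ∪ (Finset.range n).biUnion B) ∪ (O ∪ B n)
          = O ∪ (Finset.range (n + 1)).biUnion B := by
        rw [Finset.range_add_one, Finset.biUnion_insert, Finset.union_union_union_comm,
          Finset.union_self, Finset.union_comm (B n)]
      have e2 : (O ∪ (Finset.range n).biUnion B) ∩ (O ∪ B n) = O := by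
        rw [← Finset.union_inter_distrib_left, Finset.union_eq_left]
        have : Disjoint ((Finset.range n).biUnion B) (B n) := by
          rw [Finset.disjoint_biUnion_left]
          intro i hi
          rw [Finset.mem_range] at hi
          exact hB i (by omega) n (by omega) (by omega)
        rw [Finset.disjoint_iff_inter_eq_empty.1 this]
        simp
      rw [e1, e2] at h2
      rw [Finset.sum_range_succ]
      push_cast
      linarith
  have := key m le_rfl
  linarith [h0 (O ∪ (Finset.range m).biUnion B)]

/-- Adding elements whose marginals are at most `T` adds at most `T` for each of them. -/
theorem IsSubmodular.union_le_add_card_mul (hf : IsSubmodular f) {A X : Finset V} {T : ℝ}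
    (hX : ∀ u ∈ X, u ∉ A → f (insert u A) - f A ≤ T) (hXA : Disjoint X A) :
    f (A ∪ X) ≤ f A + X.card * T := by
  induction X using Finset.induction_on with
  | empty => simp
  | insert x X hx ih =>
    rw [Finset.disjoint_insert_left] at hXA
    have h1 := ih (fun u hu => hX u (by simp [hu])) hXA.2
    have h2 := hf A (A ∪ X) Finset.subset_union_left x (by simp [hXA.1, hx])
    have h3 := hX x (by simp) hXA.1
    rw [Finset.union_insert, Finset.card_insert_of_notMem hx]
    push_cast
    linarith

theorem IsSubmodular.le_card_mul (hf : IsSubmodular f) (h0 : ∀ S, 0 ≤ f S) {O : Finset V} {M : ℝ}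
    (hM : ∀ u ∈ O, f {u} ≤ M) (hO : O.Nonempty) : f O ≤ O.card * M := by
  have h : f (∅ ∪ O) ≤ f ∅ + O.card * (M - f ∅) := by
    refine hf.union_le_add_card_mul (fun u hu _ => ?_) (Finset.disjoint_empty_right _)
    have := hM u hu
    simpa using this
  have h1 : (1 : ℝ) ≤ O.card := by exact_mod_cast hO.card_pos
  rw [Finset.empty_union] at h
  nlinarith [h0 ∅]

/-- The state of one slot with threshold `T` and bins `B 0, …, B (m - 1)` of capacity `k`, after the
elements of `P` arrived. A rejected element has a small marginal with respect to each bin that is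
not full. -/
structure SlotInv (f : Finset V → ℝ) (k m : ℕ) (P : Finset V) (T : ℝ) (B : ℕ → Finset V) :
    Prop where
  subset : ∀ i < m, B i ⊆ P
  disjoint : ∀ i < m, ∀ i' < m, i ≠ i' → Disjoint (B i) (B i')
  value : ∀ i < m, (B i).card * T ≤ f (B i)
  reject : ∀ u ∈ P, (∀ i < m, u ∉ B i) → ∀ i < m, (B i).card < k →
    f (insert u (B i)) - f (B i) < T

variable {k m : ℕ} {P : Finset V} {T : ℝ} {B B' : ℕ → Finset V}

theorem SlotInv.congr (h : SlotInv f k m P T B) (hB : ∀ i < m, B' i = B i) :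
    SlotInv f k m P T B' where
  subset i hi := by rw [hB i hi]; exact h.subset i hi
  disjoint i hi i' hi' := by rw [hB i hi, hB i' hi']; exact h.disjoint i hi i' hi'
  value i hi := by rw [hB i hi]; exact h.value i hi
  reject u hu hu' i hi := by
    rw [hB i hi]
    exact h.reject u hu (fun i' hi' => by rw [← hB i' hi']; exact hu' i' hi') i hi

/-- A slot may be restarted with a threshold above all the singleton values seen so far: it would
have rejected all these elements. -/
theorem SlotInv.restart (h0 : ∀ S, 0 ≤ f S) (hP : ∀ u ∈ P, f {u} < T) (hB : ∀ i < m, B i = ∅) :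
    SlotInv f k m P T B where
  subset i hi := by simp [hB i hi]
  disjoint i hi := by simp [hB i hi]
  value i hi := by simp [hB i hi, h0]
  reject u hu _ i hi _ := by
    rw [hB i hi]
    have := hP u hu
    have := h0 ∅
    simp only [insert_empty_eq]
    linarith

theorem SlotInv.rejected (h : SlotInv f k m P T B) {v : V}
    (hr : ∀ i < m, (B i).card < k → f (insert v (B i)) - f (B i) < T) :
    SlotInv f k m (insert v P) T B where
  subset i hi := (h.subset i hi).trans (Finset.subset_insert _ _)
  disjoint := h.disjoint
  value := h.value
  reject u hu hu' i hi hk := by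
    rcases Finset.mem_insert.1 hu with rfl | hu
    · exact hr i hi hk
    · exact h.reject u hu hu' i hi hk

theorem SlotInv.accepted (hf : IsSubmodular f) (h : SlotInv f k m P T B) {v : V} (hv : v ∉ P)
    {i : ℕ} (hi : i < m) (ha : f (B i) + T ≤ f (insert v (B i))) (hB : B' i = insert v (B i))
    (hB' : ∀ i' < m, i' ≠ i → B' i' = B i') : SlotInv f k m (insert v P) T B' := by
  have hvB : ∀ i < m, v ∉ B i := fun i hi hvi => hv (h.subset i hi hvi)
  refine ⟨fun i' hi' => ?_, fun i₁ h₁ i₂ h₂ hne => ?_, fun i' hi' => ?_,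
    fun u hu hu' i' hi' hk => ?_⟩
  · by_cases e : i' = i
    · subst e; rw [hB]; exact Finset.insert_subset_insert _ (h.subset _ hi)
    · rw [hB' i' hi' e]; exact (h.subset i' hi').trans (Finset.subset_insert _ _)
  · by_cases e₁ : i₁ = i
    · subst e₁
      rw [hB, hB' i₂ h₂ hne.symm, Finset.disjoint_insert_left]
      exact ⟨hvB _ h₂, h.disjoint _ h₁ _ h₂ hne⟩
    · rw [hB' i₁ h₁ e₁]
      by_cases e₂ : i₂ = i
      · subst e₂
        rw [hB, Finset.disjoint_insert_right]
        exact ⟨hvB _ h₁, h.disjoint _ h₁ _ h₂ hne⟩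
      · rw [hB' i₂ h₂ e₂]
        exact h.disjoint _ h₁ _ h₂ hne
  · by_cases e : i' = i
    · subst e
      rw [hB, Finset.card_insert_of_notMem (hvB _ hi)]
      have := h.value _ hi
      push_cast
      linarith
    · rw [hB' i' hi' e]; exact h.value i' hi'
  · rcases Finset.mem_insert.1 hu with rfl | hu
    · exact absurd (by rw [hB]; exact Finset.mem_insert_self _ _) (hu' i hi)
    · have hBsub : ∀ i < m, u ∉ B i := by
        intro j hj huj
        by_cases e : j = i
        · subst e; exact hu' _ hj (by rw [hB]; exact Finset.mem_insert_of_mem huj)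
        · exact hu' _ hj (by rw [hB' j hj e]; exact huj)
      by_cases e : i' = i
      · subst e
        have hui := hu' _ hi'
        rw [hB] at hk ⊢
        rw [hB] at hui
        have h1 := hf (B i') (insert v (B i')) (Finset.subset_insert _ _) u hui
        rw [Finset.card_insert_of_notMem (hvB _ hi)] at hk
        have h2 := h.reject u hu hBsub i' hi (by omega)
        linarith
      · rw [hB' i' hi' e] at hk ⊢
        exact h.reject u hu hBsub i' hi' hk

/-- The approximation guarantee of one slot whose threshold `T` is right for the value of `O`: `a`
bounds the value of every feasible set inside the union of the bins. -/
theorem SlotInv.le_mul (hf : IsSubmodular f) (h0 : ∀ S, 0 ≤ f S) {O : Finset V} {ε a : ℝ}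
    (hε : 0 < ε) (hε1 : ε ≤ 1) (hm : 8 ≤ m * ε)
    (h : SlotInv f k m P T B) (hOP : O ⊆ P) (hOk : O.card ≤ k) (hcard : ∀ i < m, (B i).card ≤ k)
    (hT0 : 0 ≤ T)
    (hTl : f O ≤ (3 + ε) * (k * T)) (hTu : (3 + ε) * (k * T) ≤ (1 + ε / 2) * f O)
    (ha : ∀ S, S ⊆ (Finset.range m).biUnion B → S.card ≤ k → f S ≤ a) :
    f O ≤ (3 + ε) * a := by
  have hBU : ∀ i < m, B i ⊆ (Finset.range m).biUnion B := fun i hi =>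
    Finset.subset_biUnion_of_mem B (Finset.mem_range.2 hi)
  by_cases hfull : ∃ i < m, (B i).card = k
  · obtain ⟨i, hi, hik⟩ := hfull
    have h1 := h.value i hi
    have h2 := ha (B i) (hBU i hi) hik.le
    rw [hik] at h1
    nlinarith
  · have hlt : ∀ i < m, (B i).card < k := fun i hi =>
      lt_of_le_of_ne (hcard i hi) fun e => hfull ⟨i, hi, e⟩
    set U := (Finset.range m).biUnion B with hU
    have hb : ∀ i ∈ Finset.range m, f (O ∪ B i) ≤ 2 * a + k * T := by
      intro i hi
      rw [Finset.mem_range] at hi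
      have h1 : f ((B i ∪ O ∩ U) ∪ O \ U) ≤ f (B i ∪ O ∩ U) + (O \ U).card * T := by
        refine hf.union_le_add_card_mul (fun u hu hu' => ?_) ?_
        · have huU : u ∉ U := (Finset.mem_sdiff.1 hu).2
          have h3 := h.reject u (hOP (Finset.mem_sdiff.1 hu).1)
            (fun i hi hui => huU (hBU i hi hui)) i hi (hlt i hi)
          have h4 := hf (B i) (B i ∪ O ∩ U) Finset.subset_union_left u hu'
          linarith
        · rw [Finset.disjoint_union_right]
          exact ⟨Finset.disjoint_of_subset_right (hBU i hi) Finset.sdiff_disjoint,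
            Finset.disjoint_of_subset_right Finset.inter_subset_right Finset.sdiff_disjoint⟩
      have e : (B i ∪ O ∩ U) ∪ O \ U = O ∪ B i := by ext; simp; tauto
      rw [e] at h1
      have h2 := hf.union_le_add h0 (B i) (O ∩ U)
      have h3 := ha (B i) (hBU i hi) (hcard i hi)
      have h4 := ha (O ∩ U) Finset.inter_subset_right
        ((Finset.card_le_card Finset.inter_subset_left).trans hOk)
      have h5 : ((O \ U).card : ℝ) ≤ k := by
        exact_mod_cast (Finset.card_le_card Finset.sdiff_subset).trans hOk
      have h6 : ((O \ U).card : ℝ) * T ≤ k * T := by gcongr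
      linarith
    have hsum := Finset.sum_le_sum hb
    have hlow := hf.sub_one_mul_le_sum h0 O B m h.disjoint
    rw [Finset.sum_const, Finset.card_range, nsmul_eq_mul] at hsum
    have hm0 : (0 : ℝ) < m := by
      by_contra hc
      nlinarith
    have h7 : ((m : ℝ) - 1) * f O ≤ m * (2 * a + k * T) := hlow.trans hsum
    -- `1 ≤ m * ε / 8` pays for the set that is lost in the average
    have h8 : f O ≤ m * ε / 8 * f O := by nlinarith [h0 O]
    have h9 : (m : ℝ) * ((1 - ε / 8) * f O) ≤ m * (2 * a + k * T) := by nlinarith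
    have h10 : (1 - ε / 8) * f O ≤ 2 * a + k * T := le_of_mul_le_mul_left h9 hm0
    have h11 : (3 + ε) * ((1 - ε / 8) * f O) ≤ (3 + ε) * (2 * a) + (1 + ε / 2) * f O := by
      nlinarith
    have h12 : 0 ≤ (ε - ε ^ 2) * f O := mul_nonneg (by nlinarith) (h0 O)
    nlinarith

end Submodular

/-! ### Thresholds -/

/-- The thresholds `T 0, …, T (L - 1)` lie in the window `(M / W, M]`, and they are, up to powers of
`W`, dense up to a factor `q` on the positive reals. -/
def ThresholdInv (q W : ℝ) (L : ℕ) (M : ℝ) (T : ℕ → ℝ) : Prop :=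
  (M = 0 ∧ ∀ j < L, T j = 0) ∨
    (0 < M ∧ (∀ j < L, 0 < T j ∧ T j ≤ M ∧ M < T j * W) ∧
      ∀ y : ℝ, 0 < y → ∃ j < L, ∃ z : ℤ, T j * W ^ z ≤ y ∧ y < q * (T j * W ^ z))

theorem ThresholdInv.congr {q W M : ℝ} {L : ℕ} {T T' : ℕ → ℝ} (h : ThresholdInv q W L M T)
    (hT : ∀ j < L, T' j = T j) : ThresholdInv q W L M T' := by
  rcases h with ⟨h1, h2⟩ | ⟨h1, h2, h3⟩
  · exact Or.inl ⟨h1, fun j hj => by rw [hT j hj, h2 j hj]⟩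
  · refine Or.inr ⟨h1, fun j hj => by rw [hT j hj]; exact h2 j hj, fun y hy => ?_⟩
    obtain ⟨j, hj, z, hz⟩ := h3 y hy
    exact ⟨j, hj, z, by rw [hT j hj]; exact hz⟩

open Classical in
/-- The threshold of slot `j` after the arrival of an element with the singleton value `x`. -/
def newThreshold (q W M x : ℝ) (T : ℕ → ℝ) (j : ℕ) : ℝ :=
  if M < x ∧ T j * W ≤ x then (if M * W ≤ x then x * (1 / q) ^ j else T j * W) else T j

theorem ThresholdInv.nonneg {q W M : ℝ} {L : ℕ} {T : ℕ → ℝ} (h : ThresholdInv q W L M T) :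
    0 ≤ M := by
  rcases h with h | h
  · exact h.1.ge
  · exact h.1.le

/-- A slot that restarts gets a threshold above all the earlier singleton values. -/
theorem ThresholdInv.restart_lt {q M x : ℝ} {L : ℕ} {T : ℕ → ℝ} (hq : 1 < q)
    (h : ThresholdInv q (q ^ L) L M T) (hx : M < x) {j : ℕ} (hj : j < L) (hT : T j * q ^ L ≤ x) :
    M < newThreshold q (q ^ L) M x T j := by
  have hq0 : 0 < q := by linarith
  rw [newThreshold, if_pos ⟨hx, hT⟩]
  split_ifs with hMx
  · rw [one_div, inv_pow, ← div_eq_mul_inv, lt_div_iff₀ (by positivity)]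
    rcases h.nonneg.eq_or_lt with h0 | h0
    · rw [← h0]; simp; linarith
    · exact lt_of_lt_of_le (mul_lt_mul_of_pos_left (pow_lt_pow_right₀ hq hj) h0) hMx
  · rcases h with h | h
    · rw [h.1] at hMx hx; simp at hMx; linarith
    · exact (h.2.1 j hj).2.2

/-- Multiplying a threshold by `W` keeps it in its class modulo powers of `W`, and brings it back into
the window if the maximum grows from `M` to some `x < M * W`. For larger `x`, all the thresholds have
left the window, and a new progression starts at `x`. -/
theorem ThresholdInv.update {q M x : ℝ} {L : ℕ} {T : ℕ → ℝ} (hq : 1 < q) (hL : 0 < L)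
    (h : ThresholdInv q (q ^ L) L M T) :
    ThresholdInv q (q ^ L) L (max M x) (newThreshold q (q ^ L) M x T) := by
  have hq0 : 0 < q := by linarith
  have hW : 1 < q ^ L := one_lt_pow₀ hq (by omega)
  by_cases hx : M < x
  swap
  · have e : newThreshold q (q ^ L) M x T = T := by
      funext j; simp [newThreshold, hx]
    rw [e, max_eq_left (not_lt.1 hx)]; exact h
  rw [max_eq_right hx.le]
  have hx0 : 0 < x := h.nonneg.trans_lt hx
  refine Or.inr ⟨hx0, ?_⟩
  by_cases hMx : M * q ^ L ≤ x
  · have hT : ∀ j < L, newThreshold q (q ^ L) M x T j = x * (1 / q) ^ j := by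
      intro j hj
      have : T j * q ^ L ≤ x := by
        rcases h with h | h
        · rw [h.2 j hj]; simpa using hx0.le
        · exact le_trans (by gcongr; exact (h.2.1 j hj).2.1) hMx
      simp [newThreshold, hx, this, hMx]
    constructor
    · intro j hj
      rw [hT j hj, one_div, inv_pow]
      refine ⟨by positivity, ?_, ?_⟩
      · exact mul_le_of_le_one_right hx0.le (inv_le_one_of_one_le₀ (one_le_pow₀ hq.le))
      · rw [mul_assoc, lt_mul_iff_one_lt_right hx0, ← div_eq_inv_mul, one_lt_div (by positivity)]
        exact pow_lt_pow_right₀ hq hj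
    · intro y hy
      obtain ⟨e, he1, he2⟩ := exists_mem_Ico_zpow (x := y / x) (y := q) (by positivity) hq
      -- the exponent is `-j` modulo `L`
      have hLz : (0 : ℤ) < L := by exact_mod_cast hL
      refine ⟨((-e) % L).toNat, ?_, -((-e) / L), ?_⟩
      · have := Int.emod_lt_of_pos (-e) hLz
        omega
      · have hj : (((-e) % L).toNat : ℤ) = (-e) % L :=
          Int.toNat_of_nonneg (Int.emod_nonneg _ (by omega))
        have hj' : ((-e) % L).toNat < L := by
          have := Int.emod_lt_of_pos (-e) hLz
          omega
        have e1 : (1 / q) ^ ((-e) % L).toNat * (q ^ L) ^ (-((-e) / L)) = q ^ e := by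
          rw [one_div, ← zpow_natCast, hj, inv_zpow', ← zpow_natCast, ← zpow_mul,
            ← zpow_add₀ hq0.ne']
          congr 1
          have := Int.emod_add_mul_ediv (-e) L
          linarith
        rw [hT _ hj', mul_assoc, e1]
        rw [le_div_iff₀ hx0] at he1
        rw [div_lt_iff₀ hx0, zpow_add_one₀ hq0.ne'] at he2
        constructor <;> linarith
  · rcases h with h | ⟨hM, hwin, hcov⟩
    · rw [h.1] at hMx; simp at hMx; linarith
    push Not at hMx
    constructor
    · intro j hj
      obtain ⟨h1, h2, h3⟩ := hwin j hj
      simp only [newThreshold, hx, true_and, hMx.not_ge, if_false]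
      split_ifs with hc
      · exact ⟨by positivity, hc, by nlinarith⟩
      · exact ⟨h1, by linarith, not_le.1 hc⟩
    · intro y hy
      obtain ⟨j, hj, z, hz⟩ := hcov y hy
      simp only [newThreshold, hx, true_and, hMx.not_ge, if_false]
      by_cases hc : T j * q ^ L ≤ x
      · refine ⟨j, hj, z - 1, ?_⟩
        have : T j * q ^ L * (q ^ L) ^ (z - 1) = T j * (q ^ L) ^ z := by
          rw [mul_assoc, ← zpow_one_add₀ (by positivity)]
          congr 2; ring
        rw [if_pos hc, this]
        exact hz
      · exact ⟨j, hj, z, by rw [if_neg hc]; exact hz⟩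

/-- The window contains only one member of each class modulo powers of `W`, so that within the window
the thresholds are dense up to the factor `q`. -/
theorem ThresholdInv.exists_threshold {q W M y : ℝ} {L : ℕ} {T : ℕ → ℝ} (hq : 0 < q) (hW : 1 < W)
    (h : ThresholdInv q W L M T) (hM : 0 < M) (hy : y ≤ M) (hy' : q * M ≤ y * W) :
    ∃ j < L, T j ≤ y ∧ y < q * T j := by
  rcases h with h | ⟨_, hwin, hcov⟩
  · exact absurd h.1 hM.ne'
  have hy0 : 0 < y := by
    by_contra hc
    nlinarith [mul_pos hq hM]
  obtain ⟨j, hj, z, hz1, hz2⟩ := hcov y hy0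
  obtain ⟨h1, h2, h3⟩ := hwin j hj
  -- both `T j` and `T j * W ^ z` lie in the window `(M / W, M]`
  have hz : z = 0 := by
    have hW0 : 0 < W := by linarith
    rcases lt_trichotomy z 0 with hz | hz | hz
    · exfalso
      have : W ^ z ≤ W ^ (-1 : ℤ) := zpow_le_zpow_right₀ hW.le (by omega)
      rw [zpow_neg_one] at this
      have h4 : y < q * (M * W⁻¹) := hz2.trans_le (by gcongr)
      have h5 : y * W < q * M := by
        have := mul_lt_mul_of_pos_right h4 hW0
        rwa [mul_assoc, mul_assoc, inv_mul_cancel₀ hW0.ne', mul_one] at this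
      linarith
    · exact hz
    · exfalso
      have : W ^ (1 : ℤ) ≤ W ^ z := zpow_le_zpow_right₀ hW.le (by omega)
      rw [zpow_one] at this
      nlinarith
  subst hz
  exact ⟨j, hj, by simpa using hz1, by simpa using hz2⟩

open scoped Classical

/-! ### Insertion into a slot -/

/-- The content of the natural number cell with the fixed address `a`. -/
abbrev nvar (a : ℕ) : NExp := .load (.const a)

/-- The content of the real number cell with the fixed address `a`. -/
abbrev rvar (a : ℕ) : RExp := .load (.const a)

/-- The address of position `r` of bin `i` of slot `j`, with `k, j, i, r` in the natural number
cells `0, 2, 3, 4`. Bins have `k` cells and slots have `m` bins; cell `0` is for arrivals. -/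
def binAddr (m : ℕ) : NExp :=
  .add (.add (.const 1) (.mul (.add (.mul (nvar 2) (.const m)) (nvar 3)) (nvar 0))) (nvar 4)

/-- Load a bin into the set buffer; cell `6` gets the address of a free cell of it, or `0`. -/
def scanBin (m : ℕ) : Prog :=
  .seq .clearBuf <| .seq (.setNat (.const 6) (.const 0)) <| .seq (.setNat (.const 4) (.const 0)) <|
  .loop (.natLt (nvar 4) (nvar 0)) <|
    .seq (.ite (.occupied (binAddr m)) (.addBuf (binAddr m)) (.setNat (.const 6) (binAddr m)))
      (.setNat (.const 4) (.add (nvar 4) (.const 1)))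

/-- The threshold of the current slot. -/
def threshold : RExp := .load (.add (.const 6) (nvar 2))

/-- Put the arrived element into the current bin if the flag in cell `5` is not set, there is room,
and the marginal reaches the threshold; then set the flag. -/
def tryBin (m : ℕ) : Prog :=
  .seq (scanBin m) <|
  .ite (.and (.natEq (nvar 5) (.const 0)) (.not (.natEq (nvar 6) (.const 0))))
    (.seq (.query (.const 4)) <| .seq (.addBuf (.const 0)) <| .seq (.query (.const 5)) <|
      .ite (.realLe (.add (rvar 4) threshold) (rvar 5))
        (.seq (.copyElem (nvar 6) (.const 0)) (.setNat (.const 5) (.const 1))) .skip)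
    .skip

/-- Put the arrived element into the first bin of the current slot that accepts it. -/
def insertSlot (m : ℕ) : Prog :=
  .seq (.setNat (.const 5) (.const 0)) <| .seq (.setNat (.const 3) (.const 0)) <|
  .loop (.natLt (nvar 3) (.const m)) <|
    .seq (tryBin m) (.setNat (.const 3) (.add (nvar 3) (.const 1)))

/-- Empty all the bins of the current slot. -/
def clearSlot (m : ℕ) : Prog :=
  .seq (.setNat (.const 4) (.const 0)) <|
  .loop (.natLt (nvar 4) (.mul (.const m) (nvar 0))) <|
    .seq (.eraseElem (.add (.add (.const 1) (.mul (nvar 2) (.mul (.const m) (nvar 0)))) (nvar 4)))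
      (.setNat (.const 4) (.add (nvar 4) (.const 1)))

/-- If the threshold of the current slot has become too small, restart the slot with a larger one.
The real number cells `0, 1, 2, 3` hold the maximal singleton value so far, the singleton value of
the arrived element, the width of the window, and the threshold to use if everything restarts. -/
def refreshSlot (m : ℕ) : Prog :=
  .ite (.and (.not (.realLe (rvar 1) (rvar 0))) (.realLe (.mul threshold (rvar 2)) (rvar 1)))
    (.seq (.ite (.realLe (.mul (rvar 0) (rvar 2)) (rvar 1))
        (.setReal (.add (.const 6) (nvar 2)) (rvar 3))
        (.setReal (.add (.const 6) (nvar 2)) (.mul threshold (rvar 2))))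
      (clearSlot m))
    .skip

/-- The processing of an arriving element. -/
def arrivalProg (N m : ℕ) : Prog :=
  .seq .clearBuf <| .seq (.addBuf (.const 0)) <| .seq (.query (.const 1)) <|
  .seq (.setReal (.const 3) (rvar 1)) <| .seq (.setNat (.const 2) (.const 0)) <|
  .seq (.loop (.natLt (nvar 2) (nvar 1)) <|
    .seq (refreshSlot m) <|
    .seq (.setReal (.const 3)
      (.div (.mul (rvar 3) (.ofNat (.const N))) (.ofNat (.const (N + 1))))) <|
    .seq (insertSlot m) (.setNat (.const 2) (.add (nvar 2) (.const 1)))) <|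
  .ite (.realLe (rvar 1) (rvar 0)) .skip (.setReal (.const 0) (rvar 1))

/-- The memory bounds of the algorithm with `L` slots, `m` bins for each, and bins of size `k`. -/
def limits (k m L : ℕ) : Limits where
  natCells := 9
  natValue := 2 ^ (L * m * k) + L * m * k + 2
  realCells := 6 + L
  elemCells := L * m * k + 1
  bufSize := L * m * k + 1

theorem add_two_le_natValue (k m L : ℕ) : L * m * k + 2 ≤ (limits k m L).natValue := by
  simp only [limits]; have := Nat.two_pow_pos (L * m * k); omega

theorem addr_lt {k m L j i r : ℕ} (hj : j < L) (hi : i < m) (hr : r < k) :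
    1 + (j * m + i) * k + r < L * m * k + 1 := by
  have h1 : j * m + i + 1 ≤ L * m := by nlinarith
  have h2 : (j * m + i + 1) * k ≤ L * m * k := Nat.mul_le_mul_right k h1
  rw [Nat.succ_mul] at h2
  omega

/-- The set of the elements in the `n` cells from address `lo` on. -/
def cells (E : ℕ → WithZero V) (lo n : ℕ) : Finset V :=
  (Finset.range n).biUnion fun r => cellSet (E (lo + r))

theorem cells_succ (E : ℕ → WithZero V) (lo n : ℕ) :
    cells E lo (n + 1) = cells E lo n ∪ cellSet (E (lo + n)) := by
  rw [cells, Finset.range_add_one, Finset.biUnion_insert, Finset.union_comm]; rfl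

theorem mem_cells {E : ℕ → WithZero V} {lo n : ℕ} {v : V} :
    v ∈ cells E lo n ↔ ∃ r < n, E (lo + r) = v := by
  simp [cells, mem_cellSet]

theorem card_cells_le (E : ℕ → WithZero V) (lo n : ℕ) : (cells E lo n).card ≤ n := by
  refine Finset.card_biUnion_le.trans ?_
  refine (Finset.sum_le_sum fun r _ => card_cellSet_le (E (lo + r))).trans ?_
  simp

theorem cells_congr {E E' : ℕ → WithZero V} {lo n : ℕ} (h : ∀ r < n, E' (lo + r) = E (lo + r)) :
    cells E' lo n = cells E lo n := by
  ext v
  simp only [mem_cells]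
  exact exists_congr fun r => and_congr_right fun hr => by rw [h r hr]

/-- The elements in the `n` cells from address `lo` on are different. -/
def Tight (E : ℕ → WithZero V) (lo n : ℕ) : Prop :=
  (cells E lo n).card = ((Finset.range n).filter fun r => E (lo + r) ≠ 0).card

theorem Tight.congr {E E' : ℕ → WithZero V} {lo n : ℕ} (hE : Tight E lo n)
    (h : ∀ r < n, E' (lo + r) = E (lo + r)) : Tight E' lo n := by
  rw [Tight, cells_congr h, hE]
  congr 1
  refine Finset.filter_congr fun r hr => ?_
  rw [h r (Finset.mem_range.1 hr)]

theorem Tight.of_zero {E : ℕ → WithZero V} {lo n : ℕ} (h : ∀ r < n, E (lo + r) = 0) :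
    Tight E lo n ∧ cells E lo n = ∅ := by
  have h1 : cells E lo n = ∅ := by
    ext v
    simp only [mem_cells, Finset.notMem_empty, iff_false, not_exists, not_and]
    intro r hr
    rw [h r hr]
    exact WithZero.zero_ne_coe
  refine ⟨?_, h1⟩
  rw [Tight, h1, Finset.card_empty, eq_comm, Finset.card_eq_zero, Finset.filter_eq_empty_iff]
  intro r hr
  simp [h r (Finset.mem_range.1 hr)]

theorem Tight.card_eq {E : ℕ → WithZero V} {lo n : ℕ} (h : Tight E lo n)
    (h' : ∀ r < n, E (lo + r) ≠ 0) : (cells E lo n).card = n := by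
  rw [h, Finset.filter_true_of_mem fun r hr => h' r (Finset.mem_range.1 hr), Finset.card_range]

theorem cells_update {E : ℕ → WithZero V} {lo n r : ℕ} (hr : r < n) (h0 : E (lo + r) = 0) (v : V) :
    cells (Function.update E (lo + r) v) lo n = insert v (cells E lo n) := by
  ext u
  simp only [mem_cells, Finset.mem_insert, Function.update_apply]
  constructor
  · rintro ⟨s, hs, h⟩
    split_ifs at h with e
    · exact Or.inl (WithZero.coe_inj.1 h).symm
    · exact Or.inr ⟨s, hs, h⟩
  · rintro (rfl | ⟨s, hs, h⟩)
    · exact ⟨r, hr, by simp⟩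
    · refine ⟨s, hs, ?_⟩
      rw [if_neg, h]
      rintro e
      rw [e, h0] at h
      exact WithZero.zero_ne_coe h

theorem Tight.update {E : ℕ → WithZero V} {lo n r : ℕ} (h : Tight E lo n) (hr : r < n)
    (h0 : E (lo + r) = 0) {v : V} (hv : v ∉ cells E lo n) :
    Tight (Function.update E (lo + r) v) lo n := by
  rw [Tight, cells_update hr h0, Finset.card_insert_of_notMem hv, h]
  have : ((Finset.range n).filter fun s => Function.update E (lo + r) (v : WithZero V) (lo + s) ≠ 0)
      = insert r ((Finset.range n).filter fun s => E (lo + s) ≠ 0) := by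
    ext s
    simp only [Finset.mem_filter, Finset.mem_range, Finset.mem_insert, Function.update_apply]
    by_cases e : s = r
    · subst e; simp [hr]
    · simp [e]
  rw [this, Finset.card_insert_of_notMem (by simp [h0])]

section Slots

variable {f : Finset V → ℝ} {k m L : ℕ} {μ : Mem V}

/-- Cell addresses start at `1`, so that the value `0` of cell `6` means that the bin is full. -/
theorem scanBin_triple {j i : ℕ} (hj : j < L) (hi : i < m) (hI : Within (limits k m L) μ)
    (h0 : μ.nat 0 = k) (h2 : μ.nat 2 = j) (h3 : μ.nat 3 = i) :
    Triple f (Within (limits k m L)) (scanBin m) μ (5 * k + 7) fun μ' =>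
      (∀ a ∉ ({4, 6} : Finset ℕ), μ'.nat a = μ.nat a) ∧ μ'.real = μ.real ∧ μ'.elem = μ.elem ∧
      μ'.buf = cells μ.elem (1 + (j * m + i) * k) k ∧
      ((μ'.nat 6 = 0 ∧ ∀ r < k, μ.elem (1 + (j * m + i) * k + r) ≠ 0) ∨
        ∃ r < k, μ'.nat 6 = 1 + (j * m + i) * k + r ∧ μ.elem (1 + (j * m + i) * k + r) = 0) := by
  refine Triple.step hI (Triple.clearBuf hI rfl) (by omega) fun hI => ?_
  refine Triple.step hI (Triple.setNat hI (by simp [NExp.ev, limits]) (by simp [NExp.ev]) rfl)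
    (by omega) fun hI => ?_
  refine Triple.step hI (Triple.setNat hI (by simp [NExp.ev, limits]) (by simp [NExp.ev]) rfl)
    (by omega) fun hI => ?_
  refine Triple.mono (Triple.forLoop (T := 4) k
    (fun r μ' => (∀ a ∉ ({4, 6} : Finset ℕ), μ'.nat a = μ.nat a) ∧
      μ'.real = μ.real ∧ μ'.elem = μ.elem ∧ μ'.nat 4 = r ∧
      μ'.buf = cells μ.elem (1 + (j * m + i) * k) r ∧
      ((μ'.nat 6 = 0 ∧ ∀ r' < r, μ.elem (1 + (j * m + i) * k + r') ≠ 0) ∨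
        ∃ r' < k, μ'.nat 6 = 1 + (j * m + i) * k + r' ∧ μ.elem (1 + (j * m + i) * k + r') = 0))
    ?_ ?_ hI ?_) (by omega) ?_
  · rintro r μ' hr ⟨hn, -, -, h4, -⟩
    simp [Test.ev, NExp.ev, h4, hn 0 (by decide), h0]
  · rintro r hr μ' hI ⟨hn, hre, hel, h4, hbuf, h6⟩
    have haddr := addr_lt hj hi hr
    have ha : (binAddr m).ev μ' = 1 + (j * m + i) * k + r := by
      simp [binAddr, NExp.ev, h4, hn 0 (by decide), hn 2 (by decide), hn 3 (by decide), h0, h2, h3]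
    refine Triple.seq (T := 2) (R := fun μ'' =>
      (∀ a ∉ ({4, 6} : Finset ℕ), μ''.nat a = μ.nat a) ∧
      μ''.real = μ.real ∧ μ''.elem = μ.elem ∧ μ''.nat 4 = r ∧
      μ''.buf = cells μ.elem (1 + (j * m + i) * k) (r + 1) ∧
      ((μ''.nat 6 = 0 ∧ ∀ r' < r + 1, μ.elem (1 + (j * m + i) * k + r') ≠ 0) ∨
        ∃ r' < k, μ''.nat 6 = 1 + (j * m + i) * k + r' ∧
          μ.elem (1 + (j * m + i) * k + r') = 0)) hI ?_ (by omega) ?_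
    · refine Triple.ite hI (by omega) (fun hb => ?_) (fun hb => ?_)
      · simp only [Test.ev, ha, hel] at hb
        refine Triple.addBuf hI ?_ ?_
        · rw [hbuf]
          have := card_cells_le μ.elem (1 + (j * m + i) * k) r
          simp only [limits]; omega
        · refine ⟨hn, hre, hel, h4, ?_, ?_⟩
          · simp only [ha, hel, hbuf, cells_succ]
          · rcases h6 with h6 | h6
            · refine Or.inl ⟨h6.1, fun r' hr' => ?_⟩
              rcases Nat.lt_succ_iff_lt_or_eq.1 hr' with h | rfl
              exacts [h6.2 r' h, hb]
            · exact Or.inr h6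
      · simp only [Test.ev, ha, hel, not_not] at hb
        refine Triple.setNat hI (by simp [NExp.ev, limits]) ?_ ?_
        · rw [ha]; exact le_trans (by omega) (add_two_le_natValue k m L)
        · refine ⟨fun a h => ?_, hre, hel, by simpa [NExp.ev] using h4, ?_,
            Or.inr ⟨r, hr, ?_, hb⟩⟩
          · have : a ≠ 6 := by rintro rfl; simp at h
            simpa [NExp.ev, this] using hn a h
          · simp only [hbuf, cells_succ, hb, cellSet_zero, Finset.union_empty]
          · simp [NExp.ev, ha]
    · rintro μ'' hI ⟨hn, hre, hel, h4, hbuf, h6⟩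
      refine Triple.setNat hI (by simp [NExp.ev, limits]) ?_ ?_
      · simp only [NExp.ev, h4]; exact le_trans (by omega) (add_two_le_natValue k m L)
      · refine ⟨fun a h => ?_, hre, hel, by simp [NExp.ev, h4], hbuf, by simpa [NExp.ev] using h6⟩
        have : a ≠ 4 := by rintro rfl; simp at h
        simpa [NExp.ev, this] using hn a h
  · refine ⟨fun a h => ?_, rfl, rfl, by simp [NExp.ev], rfl, Or.inl ⟨by simp [NExp.ev], by simp⟩⟩
    simp only [Finset.mem_insert, Finset.mem_singleton, not_or] at h
    simp [NExp.ev, h.1, h.2]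
  · rintro μ' - ⟨hn, hre, hel, -, hbuf, h6⟩
    exact ⟨hn, hre, hel, hbuf, h6⟩

theorem tryBin_triple {j i : ℕ} (hj : j < L) (hi : i < m) (hI : Within (limits k m L) μ)
    (h0 : μ.nat 0 = k) (h2 : μ.nat 2 = j) (h3 : μ.nat 3 = i) :
    Triple f (Within (limits k m L)) (tryBin m) μ (5 * k + 19) fun μ' =>
      (∀ a ∉ ({4, 5, 6} : Finset ℕ), μ'.nat a = μ.nat a) ∧
      (∀ a ∉ ({4, 5} : Finset ℕ), μ'.real a = μ.real a) ∧
      ((μ'.elem = μ.elem ∧ μ'.nat 5 = μ.nat 5 ∧ (μ.nat 5 = 0 →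
          (∀ r < k, μ.elem (1 + (j * m + i) * k + r) ≠ 0) ∨
          f (cells μ.elem (1 + (j * m + i) * k) k ∪ cellSet (μ.elem 0)) <
            f (cells μ.elem (1 + (j * m + i) * k) k) + μ.real (6 + j))) ∨
        (μ.nat 5 = 0 ∧ μ'.nat 5 = 1 ∧ f (cells μ.elem (1 + (j * m + i) * k) k) + μ.real (6 + j) ≤
            f (cells μ.elem (1 + (j * m + i) * k) k ∪ cellSet (μ.elem 0)) ∧
          ∃ r < k, μ.elem (1 + (j * m + i) * k + r) = 0 ∧
            μ'.elem = Function.update μ.elem (1 + (j * m + i) * k + r) (μ.elem 0))) := by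
  refine Triple.seq hI (scanBin_triple hj hi hI h0 h2 h3) (by omega) ?_
  rintro μ₁ hI ⟨hn, hre, hel, hbuf, h6⟩
  have h5 : μ₁.nat 5 = μ.nat 5 := hn 5 (by decide)
  have e5 : (6 + j = 5) = False := by simp; omega
  have e4 : (6 + j = 4) = False := by simp; omega
  refine Triple.ite hI (by omega) (fun hb => ?_) (fun hb => ?_)
  · simp only [Test.ev, NExp.ev, h5] at hb
    obtain ⟨hb5, hb6⟩ := hb
    rcases h6 with h6 | ⟨r, hr, h6, hr0⟩
    · exact absurd h6.1 hb6
    have haddr := addr_lt hj hi hr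
    refine Triple.step hI (Triple.query hI (by simp only [NExp.ev, limits]; omega) rfl)
      (by omega) fun hI => ?_
    refine Triple.step hI (Triple.addBuf hI ?_ rfl) (by omega) fun hI => ?_
    · have h1 := card_cells_le μ.elem (1 + (j * m + i) * k) k
      have h2 := addr_lt (k := k) (r := k - 1) hj hi (by omega)
      simp only [hbuf, limits]; omega
    refine Triple.step hI (Triple.query hI (by simp only [NExp.ev, limits]; omega) rfl)
      (by omega) fun hI => ?_
    refine Triple.ite hI (by omega) (fun hb => ?_) (fun hb => ?_)
    · refine Triple.step hI (Triple.copyElem hI (by simp only [NExp.ev, limits, h6]; omega) rfl)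
        (by omega) fun hI => ?_
      refine Triple.leaf (Triple.setNat hI (by simp [NExp.ev, limits])
        (by simp [NExp.ev, limits]) ?_) (by omega)
      refine ⟨fun a h => ?_, fun a h => ?_, Or.inr ⟨hb5, by simp [NExp.ev], ?_, r, hr, hr0, ?_⟩⟩
      · simp only [Finset.mem_insert, Finset.mem_singleton, not_or] at h
        simpa [NExp.ev, h] using hn a (by simp [h])
      · simp only [Finset.mem_insert, Finset.mem_singleton, not_or] at h
        simp [NExp.ev, h, hre]
      · simpa [Test.ev, NExp.ev, RExp.ev, threshold, Function.update_apply, hbuf, hel, hre,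
          hn 2 (by decide), h2, e5, e4] using hb
      · simp [NExp.ev, h6, hel]
    · refine Triple.leaf (Triple.skip hI ?_) (by omega)
      refine ⟨fun a h => ?_, fun a h => ?_, Or.inl ⟨hel, h5, fun _ => Or.inr ?_⟩⟩
      · simp only [Finset.mem_insert, Finset.mem_singleton, not_or] at h
        exact hn a (by simp [h])
      · simp only [Finset.mem_insert, Finset.mem_singleton, not_or] at h
        simp [NExp.ev, h, hre]
      · simpa [Test.ev, NExp.ev, RExp.ev, threshold, Function.update_apply, hbuf, hel, hre,
          hn 2 (by decide), h2, e5, e4] using hb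
  · refine Triple.leaf (Triple.skip hI ?_) (by omega)
    refine ⟨fun a h => ?_, fun a _ => by rw [hre], Or.inl ⟨hel, h5, fun h => Or.inl ?_⟩⟩
    · simp only [Finset.mem_insert, Finset.mem_singleton, not_or] at h
      exact hn a (by simp [h])
    · simp only [Test.ev, NExp.ev, h5, h, true_and, not_not] at hb
      rcases h6 with h6 | ⟨r, hr, h6, hr0⟩
      · exact h6.2
      · omega

end Slots

/-! ### Arrivals -/

section Arrival

variable {f : Finset V → ℝ} {k m L : ℕ} {μ : Mem V} {P : Finset V}

theorem addr_mem_slot {j i r : ℕ} (hi : i < m) (hr : r < k) :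
    1 + j * (m * k) ≤ 1 + (j * m + i) * k + r ∧
      1 + (j * m + i) * k + r < 1 + (j + 1) * (m * k) := by
  have h1 : (j * m + i) * k = j * (m * k) + i * k := by ring
  have h2 : (i + 1) * k ≤ m * k := Nat.mul_le_mul_right k hi
  rw [Nat.succ_mul] at h2
  rw [h1, Nat.succ_mul]
  omega

/-- The cells of different bins are different. -/
theorem eq_of_addr_eq {a b r s : ℕ} (hr : r < k) (hs : s < k) (h : a * k + r = b * k + s) :
    a = b := by
  rcases lt_trichotomy a b with hab | hab | hab
  · have := Nat.mul_le_mul_right k hab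
    rw [Nat.succ_mul] at this
    omega
  · exact hab
  · have := Nat.mul_le_mul_right k hab
    rw [Nat.succ_mul] at this
    omega

/-- Slot `j` of the element memory `E` satisfies the invariant, and no bin stores an element twice,
so that a bin is full exactly if it has no free cell. -/
def SlotMem (f : Finset V → ℝ) (k m : ℕ) (P : Finset V) (T : ℝ) (E : ℕ → WithZero V) (j : ℕ) :
    Prop :=
  SlotInv f k m P T (fun i => cells E (1 + (j * m + i) * k) k) ∧
    ∀ i < m, Tight E (1 + (j * m + i) * k) k

theorem SlotMem.congr {T : ℝ} {E E' : ℕ → WithZero V} {j : ℕ} (h : SlotMem f k m P T E j)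
    (hE : ∀ a, 1 + j * (m * k) ≤ a → a < 1 + (j + 1) * (m * k) → E' a = E a) :
    SlotMem f k m P T E' j := by
  have : ∀ i < m, ∀ r < k, E' (1 + (j * m + i) * k + r) = E (1 + (j * m + i) * k + r) :=
    fun i hi r hr => hE _ (addr_mem_slot hi hr).1 (addr_mem_slot hi hr).2
  exact ⟨h.1.congr fun i hi => cells_congr (this i hi), fun i hi => (h.2 i hi).congr (this i hi)⟩

theorem SlotMem.restart (h0 : ∀ S, 0 ≤ f S) {T : ℝ} (hP : ∀ u ∈ P, f {u} < T)
    {E : ℕ → WithZero V} {j : ℕ}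
    (hE : ∀ a, 1 + j * (m * k) ≤ a → a < 1 + (j + 1) * (m * k) → E a = 0) :
    SlotMem f k m P T E j := by
  have : ∀ i < m, ∀ r < k, E (1 + (j * m + i) * k + r) = 0 :=
    fun i hi r hr => hE _ (addr_mem_slot hi hr).1 (addr_mem_slot hi hr).2
  exact ⟨SlotInv.restart h0 hP fun i hi => (Tight.of_zero (this i hi)).2,
    fun i hi => (Tight.of_zero (this i hi)).1⟩

theorem SlotMem.update (hf : IsSubmodular f) {T : ℝ} {E : ℕ → WithZero V} {j i r : ℕ}
    (h : SlotMem f k m P T E j) (hi : i < m) (hr : r < k)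
    (h0 : E (1 + (j * m + i) * k + r) = 0) {v : V} (hv : v ∉ P)
    (ha : f (cells E (1 + (j * m + i) * k) k) + T ≤
      f (insert v (cells E (1 + (j * m + i) * k) k))) :
    SlotMem f k m (insert v P) T (Function.update E (1 + (j * m + i) * k + r) v) j := by
  have hne : ∀ i' < m, i' ≠ i → ∀ s < k,
      Function.update E (1 + (j * m + i) * k + r) (v : WithZero V) (1 + (j * m + i') * k + s) =
        E (1 + (j * m + i') * k + s) := by
    intro i' _ hii s hs
    refine Function.update_of_ne (fun e => hii ?_) _ _
    have : j * m + i' = j * m + i := eq_of_addr_eq (k := k) hs hr (by omega)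
    omega
  refine ⟨h.1.accepted hf hv hi ha (cells_update hr h0 v)
    fun i' hi' hii => cells_congr (hne i' hi' hii), fun i' hi' => ?_⟩
  by_cases e : i' = i
  · subst e
    exact (h.2 i' hi').update hr h0 fun hvi => hv (h.1.subset i' hi' hvi)
  · exact (h.2 i' hi').congr (hne i' hi' e)

/-- As long as the flag is not set, the slot is unchanged and all the bins visited have rejected the
element; once it is set, the slot contains the element. -/
theorem insertSlot_triple (hf : IsSubmodular f) {j : ℕ} (hj : j < L) {v : V} (hv : v ∉ P)
    (hk : 1 ≤ k) (hI : Within (limits k m L) μ) (h0 : μ.nat 0 = k) (h2 : μ.nat 2 = j)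
    (hE : μ.elem 0 = v) (hS : SlotMem f k m P (μ.real (6 + j)) μ.elem j) :
    Triple f (Within (limits k m L)) (insertSlot m) μ (m * (5 * k + 21 + 1) + 5) fun μ' =>
      (∀ a ∉ ({3, 4, 5, 6} : Finset ℕ), μ'.nat a = μ.nat a) ∧
      (∀ a ∉ ({4, 5} : Finset ℕ), μ'.real a = μ.real a) ∧
      (∀ a, a < 1 + j * (m * k) ∨ 1 + (j + 1) * (m * k) ≤ a → μ'.elem a = μ.elem a) ∧
      SlotMem f k m (insert v P) (μ.real (6 + j)) μ'.elem j := by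
  have hmD : m ≤ L * m * k := by
    calc m = 1 * m * 1 := by ring
      _ ≤ L * m * k := Nat.mul_le_mul (Nat.mul_le_mul_right m (by omega)) hk
  refine Triple.step hI (Triple.setNat hI (by simp [NExp.ev, limits]) (by simp [NExp.ev]) rfl)
    (by omega) fun hI => ?_
  refine Triple.step hI (Triple.setNat hI (by simp [NExp.ev, limits]) (by simp [NExp.ev]) rfl)
    (by omega) fun hI => ?_
  refine Triple.mono (Triple.forLoop (T := 5 * k + 21) m
    (fun i μ' => (∀ a ∉ ({3, 4, 5, 6} : Finset ℕ), μ'.nat a = μ.nat a) ∧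
      (∀ a ∉ ({4, 5} : Finset ℕ), μ'.real a = μ.real a) ∧
      (∀ a, a < 1 + j * (m * k) ∨ 1 + (j + 1) * (m * k) ≤ a → μ'.elem a = μ.elem a) ∧
      μ'.nat 3 = i ∧
      ((μ'.nat 5 = 0 ∧ μ'.elem = μ.elem ∧
          ∀ i' < i, (cells μ.elem (1 + (j * m + i') * k) k).card < k →
            f (insert v (cells μ.elem (1 + (j * m + i') * k) k)) -
              f (cells μ.elem (1 + (j * m + i') * k) k) < μ.real (6 + j)) ∨
        (μ'.nat 5 = 1 ∧ SlotMem f k m (insert v P) (μ.real (6 + j)) μ'.elem j)))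
    ?_ ?_ hI ?_) (by omega) ?_
  · rintro r μ' hr ⟨hn, -, -, h3, -⟩
    simp [Test.ev, NExp.ev, h3]
  · rintro i hi μ' hI ⟨hn, hre, hel, h3, h5⟩
    refine Triple.seq hI (tryBin_triple hj hi hI (by rw [hn 0 (by decide), h0])
      (by rw [hn 2 (by decide), h2]) h3) (by omega) ?_
    rintro μ₁ hI ⟨hn1, hre1, hel1⟩
    refine Triple.leaf (Triple.setNat hI (by simp [NExp.ev, limits]) ?_ ?_) (by omega)
    · simp only [NExp.ev, hn1 3 (by decide), h3]
      exact le_trans (by omega) (add_two_le_natValue k m L)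
    have hE' : μ'.elem 0 = v := by rw [hel 0 (by omega), hE]
    have hT : μ'.real (6 + j) = μ.real (6 + j) := hre _ (by simp; omega)
    rw [hE', hT, cellSet_coe, Finset.union_comm, ← Finset.insert_eq] at hel1
    refine ⟨fun a h => ?_, fun a h => ?_, fun a h => ?_, by simp [NExp.ev, hn1 3 (by decide), h3],
      ?_⟩
    · simp only [Finset.mem_insert, Finset.mem_singleton, not_or] at h
      simp [NExp.ev, h, hn1 a, hn a]
    · rw [← hre a h]; exact hre1 a h
    · rcases hel1 with ⟨he, -⟩ | ⟨-, -, -, r, hr, -, he⟩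
      · simp only [he]; exact hel a h
      · have := addr_mem_slot (j := j) hi hr
        simp only [he]
        rw [Function.update_of_ne (by omega)]
        exact hel a h
    · simp only [NExp.ev, Function.update_of_ne (show (5 : ℕ) ≠ 3 by decide)]
      rcases h5 with ⟨h5, he, hrej⟩ | ⟨h5, hS'⟩
      · rw [he] at hel1
        rcases hel1 with ⟨he1, h51, hr⟩ | ⟨-, h51, hacc, r, hr, hr0, he1⟩
        · refine Or.inl ⟨by omega, he1, fun i' hi' hc => ?_⟩
          rcases Nat.lt_succ_iff_lt_or_eq.1 hi' with h | rfl
          · exact hrej i' h hc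
          · rcases hr h5 with hr | hr
            · have := (hS.2 i' hi).card_eq hr
              omega
            · linarith
        · refine Or.inr ⟨h51, ?_⟩
          rw [he1]
          exact hS.update hf hi hr hr0 hv hacc
      · rcases hel1 with ⟨he1, h51, hr⟩ | ⟨h, -⟩
        · exact Or.inr ⟨by omega, by rw [he1]; exact hS'⟩
        · omega
  · refine ⟨fun a h => ?_, fun _ _ => rfl, fun _ _ => rfl, by simp [NExp.ev],
      Or.inl ⟨by simp [NExp.ev], rfl, by simp⟩⟩
    simp only [Finset.mem_insert, Finset.mem_singleton, not_or] at h
    simp [NExp.ev, h]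
  · rintro μ' - ⟨hn, hre, hel, -, h5⟩
    refine ⟨hn, hre, hel, ?_⟩
    rcases h5 with ⟨-, he, hrej⟩ | ⟨-, hS'⟩
    · rw [he]
      exact ⟨hS.1.rejected hrej, hS.2⟩
    · exact hS'

theorem clearSlot_triple {j : ℕ} (hj : j < L) (hI : Within (limits k m L) μ) (h0 : μ.nat 0 = k)
    (h2 : μ.nat 2 = j) :
    Triple f (Within (limits k m L)) (clearSlot m) μ (m * k * 4 + 3) fun μ' =>
      (∀ a ∉ ({4} : Finset ℕ), μ'.nat a = μ.nat a) ∧ μ'.real = μ.real ∧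
      (∀ a, a < 1 + j * (m * k) ∨ 1 + (j + 1) * (m * k) ≤ a → μ'.elem a = μ.elem a) ∧
      ∀ a, 1 + j * (m * k) ≤ a → a < 1 + (j + 1) * (m * k) → μ'.elem a = 0 := by
  have hD : (j + 1) * (m * k) ≤ L * m * k := by
    rw [mul_assoc]; exact Nat.mul_le_mul_right _ hj
  rw [Nat.succ_mul] at hD ⊢
  refine Triple.step hI (Triple.setNat hI (by simp [NExp.ev, limits]) (by simp [NExp.ev]) rfl)
    (by omega) fun hI => ?_
  refine Triple.mono (Triple.forLoop (T := 3) (m * k)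
    (fun s μ' => (∀ a ∉ ({4} : Finset ℕ), μ'.nat a = μ.nat a) ∧ μ'.real = μ.real ∧ μ'.nat 4 = s ∧
      (∀ a, a < 1 + j * (m * k) ∨ 1 + (j * (m * k) + m * k) ≤ a → μ'.elem a = μ.elem a) ∧
      ∀ a, 1 + j * (m * k) ≤ a → a < 1 + j * (m * k) + s → μ'.elem a = 0)
    ?_ ?_ hI ?_) (by omega) ?_
  · rintro r μ' hr ⟨hn, -, h4, -⟩
    simp [Test.ev, NExp.ev, h4, hn 0 (by decide), h0]
  · rintro s hs μ' hI ⟨hn, hre, h4, hel, hel'⟩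
    refine Triple.step hI (Triple.eraseElem hI rfl) (by omega) fun hI => ?_
    refine Triple.leaf (Triple.setNat hI (by simp [NExp.ev, limits]) ?_ ?_) (by omega)
    · simp only [NExp.ev, h4]
      exact le_trans (by omega) (add_two_le_natValue k m L)
    · simp only [NExp.ev, h4, hn 0 (by decide), hn 2 (by decide), h0, h2]
      refine ⟨fun a h => ?_, hre, by simp, fun a h => ?_, fun a h h' => ?_⟩
      · have : a ≠ 4 := by simpa using h
        simpa [this] using hn a h
      · rw [Function.update_of_ne (by omega)]
        exact hel a h
      · rw [Function.update_apply]
        split_ifs with e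
        · rfl
        · exact hel' a h (by omega)
  · refine ⟨fun a h => ?_, rfl, by simp [NExp.ev], fun _ _ => rfl, fun a h h' => by omega⟩
    have : a ≠ 4 := by simpa using h
    simp [NExp.ev, this]
  · rintro μ' - ⟨hn, hre, -, hel, hel'⟩
    exact ⟨hn, hre, hel, fun a h h' => hel' a h (by omega)⟩

theorem refreshSlot_triple {q : ℝ} (hq : 1 < q) {M x : ℝ} {j : ℕ} (hj : j < L)
    (hI : Within (limits k m L) μ) (h0 : μ.nat 0 = k) (h2 : μ.nat 2 = j) {T : ℕ → ℝ}
    (hM : μ.real 0 = M) (hx : μ.real 1 = x) (hW : μ.real 2 = q ^ L)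
    (hτ : μ.real 3 = x * (1 / q) ^ j) (hT : μ.real (6 + j) = T j)
    (hTI : ThresholdInv q (q ^ L) L M T) (hf0 : ∀ S, 0 ≤ f S) (hP : ∀ u ∈ P, f {u} ≤ M)
    (hS : SlotMem f k m P (T j) μ.elem j) :
    Triple f (Within (limits k m L)) (refreshSlot m) μ (m * k * 4 + 7) fun μ' =>
      (∀ a ∉ ({4} : Finset ℕ), μ'.nat a = μ.nat a) ∧
      (∀ a, a ≠ 6 + j → μ'.real a = μ.real a) ∧
      μ'.real (6 + j) = newThreshold q (q ^ L) M x T j ∧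
      (∀ a, a < 1 + j * (m * k) ∨ 1 + (j + 1) * (m * k) ≤ a → μ'.elem a = μ.elem a) ∧
      SlotMem f k m P (newThreshold q (q ^ L) M x T j) μ'.elem j := by
  have hth : threshold.ev μ = T j := by simp [threshold, RExp.ev, NExp.ev, h2, hT]
  refine Triple.ite hI (by omega) (fun hb => ?_) (fun hb => ?_)
  · simp only [Test.ev, RExp.ev, hth, NExp.ev, hx, hM, hW, not_le] at hb
    refine Triple.seq (T := 2) (R := fun μ' => μ' = ⟨μ.nat,
      Function.update μ.real (6 + j) (newThreshold q (q ^ L) M x T j), μ.elem, μ.buf⟩) hI ?_ (by omega) ?_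
    · refine Triple.ite hI (by omega) (fun hb' => ?_) (fun hb' => ?_)
      · simp only [Test.ev, RExp.ev, NExp.ev, hx, hM, hW] at hb'
        refine Triple.setReal hI (by simp [NExp.ev, limits, h2, hj]) ?_
        simp [NExp.ev, RExp.ev, h2, hτ, newThreshold, hb, hb']
      · simp only [Test.ev, RExp.ev, NExp.ev, hx, hM, hW] at hb'
        refine Triple.setReal hI (by simp [NExp.ev, limits, h2, hj]) ?_
        simp [NExp.ev, RExp.ev, h2, hth, hW, newThreshold, hb, hb']
    · rintro _ hI rfl
      refine (clearSlot_triple hj hI h0 h2).mono (by omega) ?_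
      rintro μ' - ⟨hn, hre, hel, hel'⟩
      refine ⟨hn, fun a h => by simp [hre, h], by simp [hre], hel, SlotMem.restart hf0 ?_ hel'⟩
      exact fun u hu => (hP u hu).trans_lt (hTI.restart_lt hq hb.1 hj hb.2)
  · simp only [Test.ev, RExp.ev, hth, NExp.ev, hx, hM, hW, not_le] at hb
    have e : newThreshold q (q ^ L) M x T j = T j := by simp only [newThreshold, hb, if_false]
    refine Triple.leaf (Triple.skip hI ?_) (by omega)
    rw [e]
    exact ⟨fun _ _ => rfl, fun _ _ => rfl, hT, fun _ _ => rfl, hS⟩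

/-- What holds between two arrivals, when the elements of `P` have arrived. -/
structure StreamInv (f : Finset V → ℝ) (k m L : ℕ) (q : ℝ) (P : Finset V) (μ : Mem V) : Prop where
  bound : μ.nat 0 = k
  slots : μ.nat 1 = L
  width : μ.real 2 = q ^ L
  singleton_le : ∀ u ∈ P, f {u} ≤ μ.real 0
  exists_singleton : μ.real 0 = 0 ∨ ∃ u ∈ P, f {u} = μ.real 0
  thresholds : ThresholdInv q (q ^ L) L (μ.real 0) fun j => μ.real (6 + j)
  slotMem : ∀ j < L, SlotMem f k m P (μ.real (6 + j)) μ.elem j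

/-- A bound for the time to process one element. -/
def arrivalTime (k m L : ℕ) : ℕ := L * (m * k * 4 + m * (5 * k + 21 + 1) + 18 + 1) + 20

theorem arrivalProg_triple (hf : IsSubmodular f) (hf0 : ∀ S, 0 ≤ f S) {N : ℕ} (hN : 1 ≤ N)
    (hk : 1 ≤ k) (hm : 1 ≤ m) (hL : 1 ≤ L) {v : V} (hv : v ∉ P) (hI : Within (limits k m L) μ)
    (h : StreamInv f k m L (1 + 1 / N) P μ) (hE : μ.elem 0 = v) :
    Triple f (Within (limits k m L)) (arrivalProg N m) μ (arrivalTime k m L)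
      (StreamInv f k m L (1 + 1 / N) (insert v P)) := by
  have hN0 : (0 : ℝ) < N := by exact_mod_cast hN
  obtain ⟨q, hqdef⟩ : ∃ q : ℝ, q = 1 + 1 / N := ⟨_, rfl⟩
  rw [← hqdef] at h ⊢
  have hq : 1 < q := by rw [hqdef]; linarith [one_div_pos.2 hN0]
  have hLD : L ≤ L * m * k := by
    rw [mul_assoc]; exact Nat.le_mul_of_pos_right _ (Nat.mul_pos hm hk)
  set x := f {v} with hxdef
  set T : ℕ → ℝ := fun j => μ.real (6 + j) with hTdef
  set M := μ.real 0 with hMdef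
  rw [arrivalTime]
  refine Triple.step hI (Triple.clearBuf hI rfl) (by omega) fun hI => ?_
  refine Triple.step hI (Triple.addBuf hI (by simp [limits]) rfl) (by omega) fun hI => ?_
  refine Triple.step hI (Triple.query hI (by simp only [NExp.ev, limits]; omega) rfl) (by omega)
    fun hI => ?_
  refine Triple.step hI (Triple.setReal hI (by simp only [NExp.ev, limits]; omega) rfl) (by omega)
    fun hI => ?_
  refine Triple.step hI (Triple.setNat hI (by simp [NExp.ev, limits]) (by simp [NExp.ev]) rfl)
    (by omega) fun hI => ?_
  refine Triple.seq hI (Triple.forLoop (T := m * k * 4 + m * (5 * k + 21 + 1) + 18) L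
    (fun j μ' => (∀ a ∉ ({2, 3, 4, 5, 6} : Finset ℕ), μ'.nat a = μ.nat a) ∧ μ'.nat 2 = j ∧
      μ'.real 0 = M ∧ μ'.real 1 = x ∧ μ'.real 2 = q ^ L ∧ μ'.real 3 = x * (1 / q) ^ j ∧
      μ'.elem 0 = v ∧
      (∀ j' < L, j' < j → μ'.real (6 + j') = newThreshold q (q ^ L) M x T j' ∧
        SlotMem f k m (insert v P) (newThreshold q (q ^ L) M x T j') μ'.elem j') ∧
      ∀ j' < L, j ≤ j' → μ'.real (6 + j') = T j' ∧ SlotMem f k m P (T j') μ'.elem j')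
    ?_ ?_ hI ?_) (by omega) ?_
  · rintro j μ' hj ⟨hn, h2, -⟩
    simp [Test.ev, NExp.ev, h2, hn 1 (by decide), h.slots]
  · rintro j hj μ₁ hI ⟨hn, h2, hM, hx, hW, hτ, hE, hlt, hge⟩
    obtain ⟨hTj, hSj⟩ := hge j hj le_rfl
    refine Triple.seq hI (refreshSlot_triple hq hj hI (by rw [hn 0 (by decide), h.bound]) h2 hM hx
      hW hτ hTj h.thresholds hf0 h.singleton_le hSj) (by omega) ?_
    rintro μ₂ hI ⟨hn', hre', hTj', hel', hSj'⟩
    refine Triple.step hI (Triple.setReal hI (by simp only [NExp.ev, limits]; omega) rfl) (by omega)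
      fun hI => ?_
    have e3 : (6 + j = 3) = False := by simp; omega
    refine Triple.seq hI (insertSlot_triple hf hj hv hk hI ?_ ?_ ?_ ?_) (by omega) ?_
    · simp only [hn' 0 (by decide), hn 0 (by decide), h.bound]
    · simp only [hn' 2 (by decide), h2]
    · simp only [hel' 0 (by omega), hE]
    · simpa [NExp.ev, Function.update_apply, e3, hTj'] using hSj'
    rintro μ₃ hI ⟨hn'', hre'', hel'', hSj''⟩
    simp only [NExp.ev, Function.update_apply, e3, if_false, hTj'] at hSj'' hre'' hn''
    have hfar : ∀ j', j' ≠ j → ∀ a, 1 + j' * (m * k) ≤ a → a < 1 + (j' + 1) * (m * k) →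
        μ₃.elem a = μ₁.elem a := by
      intro j' hne a h1 h2
      have : a < 1 + j * (m * k) ∨ 1 + (j + 1) * (m * k) ≤ a := by
        rcases Nat.lt_or_gt_of_ne hne with h | h
        · have := Nat.mul_le_mul_right (m * k) h
          exact Or.inl (by simp only [Nat.succ_eq_add_one] at this; omega)
        · have := Nat.mul_le_mul_right (m * k) h
          exact Or.inr (by simp only [Nat.succ_eq_add_one] at this; omega)
      rw [hel'' a this]
      exact hel' a this
    have hreal : ∀ a ∉ ({3, 4, 5} : Finset ℕ), a ≠ 6 + j → μ₃.real a = μ₁.real a := by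
      intro a ha hne
      simp only [Finset.mem_insert, Finset.mem_singleton, not_or] at ha
      rw [hre'' a (by simp [ha]), if_neg ha.1, hre' a hne]
    refine Triple.leaf (Triple.setNat hI (by simp [NExp.ev, limits]) ?_ ?_) (by omega)
    · simp only [NExp.ev, hn'' 2 (by decide), hn' 2 (by decide), h2]
      exact le_trans (by omega) (add_two_le_natValue k m L)
    · refine ⟨fun a ha => ?_, ?_, ?_, ?_, ?_, ?_, ?_, fun j' hj' hjj => ?_, fun j' hj' hjj => ?_⟩
      · simp only [Finset.mem_insert, Finset.mem_singleton, not_or] at ha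
        simp [NExp.ev, ha, hn'' a, hn' a, hn a]
      · simp [NExp.ev, hn'' 2, hn' 2, h2]
      · rw [← hM]; exact hreal 0 (by decide) (by omega)
      · rw [← hx]; exact hreal 1 (by decide) (by omega)
      · rw [← hW]; exact hreal 2 (by decide) (by omega)
      · dsimp only
        rw [hre'' 3 (by decide), if_pos rfl]
        simp only [RExp.ev, NExp.ev, hre' 3 (by omega), hτ, pow_succ]
        rw [hqdef]
        push_cast
        field_simp
      · dsimp only
        rw [hel'' 0 (by omega)]
        simp only [hel' 0 (by omega), hE]
      · rcases Nat.lt_succ_iff_lt_or_eq.1 hjj with hlt' | rfl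
        · obtain ⟨h1, h2⟩ := hlt j' hj' hlt'
          refine ⟨?_, h2.congr (hfar j' (by omega))⟩
          rw [← h1]
          exact hreal _ (by simp; omega) (by omega)
        · refine ⟨?_, hSj''⟩
          dsimp only
          rw [hre'' _ (by simp; omega), if_neg (by omega), hTj']
      · obtain ⟨h1, h2⟩ := hge j' hj' (by omega)
        refine ⟨?_, h2.congr (hfar j' (by omega))⟩
        rw [← h1]
        exact hreal _ (by simp; omega) (by omega)
  · refine ⟨fun a ha => ?_, ?_, ?_, ?_, ?_, ?_, hE, fun j' _ h => by omega, fun j' hj' _ => ?_⟩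
    · simp only [Finset.mem_insert, Finset.mem_singleton, not_or] at ha
      simp [NExp.ev, ha]
    · simp [NExp.ev]
    · simp [NExp.ev, hMdef]
    · simp [NExp.ev, hE, hxdef]
    · simp [NExp.ev, h.width]
    · simp [NExp.ev, RExp.ev, hE, hxdef]
    · have e : 6 + j' ≠ 3 ∧ 6 + j' ≠ 1 := by omega
      refine ⟨?_, h.slotMem j' hj'⟩
      simp only [NExp.ev, Function.update_apply, e.1, e.2, if_false, hTdef]
  · rintro μ₁ hI ⟨hn, -, hM, hx, hW, -, -, hlt, -⟩
    have hnew := h.thresholds.update (x := x) hq hL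
    have key : ∀ μ' : Mem V, μ'.nat = μ₁.nat → (∀ a, a ≠ 0 → μ'.real a = μ₁.real a) →
        μ'.elem = μ₁.elem → μ'.real 0 = max M x →
        StreamInv f k m L q (insert v P) μ' := by
      intro μ' h1 h2 h3 h4
      have hreal : ∀ j < L, μ'.real (6 + j) = newThreshold q (q ^ L) M x T j := fun j hj => by
        rw [h2 _ (by omega), (hlt j hj hj).1]
      refine ⟨?_, ?_, ?_, ?_, ?_, ?_, ?_⟩
      · rw [h1, hn 0 (by decide), h.bound]
      · rw [h1, hn 1 (by decide), h.slots]
      · rw [h2 2 (by omega), hW]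
      · intro u hu
        rw [h4]
        rcases Finset.mem_insert.1 hu with rfl | hu
        · exact le_max_right _ _
        · exact (h.singleton_le u hu).trans (le_max_left _ _)
      · rw [h4]
        rcases le_total x M with hxM | hxM
        · rw [max_eq_left hxM]
          rcases h.exists_singleton with h | ⟨u, hu, h⟩
          · exact Or.inl h
          · exact Or.inr ⟨u, Finset.mem_insert_of_mem hu, h⟩
        · rw [max_eq_right hxM]
          exact Or.inr ⟨v, Finset.mem_insert_self _ _, rfl⟩
      · rw [h4]
        exact hnew.congr fun j hj => hreal j hj
      · intro j hj
        rw [hreal j hj, h3]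
        exact (hlt j hj hj).2
    refine Triple.ite hI (by omega) (fun hb => ?_) (fun hb => ?_)
    · simp only [Test.ev, RExp.ev, NExp.ev, hx, hM] at hb
      refine Triple.leaf (Triple.skip hI (key _ rfl (fun _ _ => rfl) rfl ?_)) (by omega)
      rw [hM, max_eq_left hb]
    · simp only [Test.ev, RExp.ev, NExp.ev, hx, hM, not_le] at hb
      refine Triple.leaf (Triple.setReal hI (by simp only [NExp.ev, limits]; omega)
        (key _ rfl (fun a ha => ?_) rfl ?_)) (by omega)
      · simp [NExp.ev, ha]
      · simp [NExp.ev, RExp.ev, hx, max_eq_right hb.le]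

end Arrival

/-! ### Initialization -/

/-- Compute the number of slots, in the natural number cell `1`, and the width of the window of
thresholds, in the real number cell `2`. -/
def initProg (N : ℕ) : Prog :=
  .seq (.setReal (.const 2) (.ofNat (.const 1))) <|
  .loop (.not (.realLe (.mul (.ofNat (.const 8)) (.ofNat (nvar 0))) (rvar 2))) <|
    .seq (.setReal (.const 2)
      (.div (.mul (rvar 2) (.ofNat (.const (N + 1)))) (.ofNat (.const N))))
      (.setNat (.const 1) (.add (nvar 1) (.const 1)))

/-- By Bernoulli's inequality, `(1 + 1 / N) ^ N` is at least `2`. -/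
theorem le_one_add_pow (N k : ℕ) (hN : 1 ≤ N) :
    (8 * k : ℝ) ≤ (1 + 1 / N) ^ (N * (8 * k).size) := by
  have hN0 : (0 : ℝ) < N := by exact_mod_cast hN
  have h2 : (2 : ℝ) ≤ (1 + 1 / N) ^ N := by
    have := one_add_mul_le_pow (a := (1 / N : ℝ)) (by have := one_div_pos.2 hN0; linarith) N
    rw [mul_one_div_cancel hN0.ne'] at this
    linarith
  have h3 : ((8 * k : ℕ) : ℝ) < (2 : ℝ) ^ (8 * k).size := by exact_mod_cast Nat.lt_size_self _
  push_cast at h3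
  rw [pow_mul]
  exact h3.le.trans (pow_le_pow_left₀ (by norm_num) h2 _)

/-- The number of slots: the least `l` with `8 k ≤ (1 + 1 / N) ^ l`, which exists for `N ≥ 1`. -/
def numSlots (N k : ℕ) : ℕ := sInf {l : ℕ | (8 * k : ℝ) ≤ (1 + 1 / N) ^ l}

theorem le_pow_numSlots {N k : ℕ} (hN : 1 ≤ N) : (8 * k : ℝ) ≤ (1 + 1 / N) ^ numSlots N k :=
  Nat.sInf_mem (s := {l : ℕ | (8 * k : ℝ) ≤ (1 + 1 / N) ^ l}) ⟨_, le_one_add_pow N k hN⟩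

theorem numSlots_le {N k : ℕ} (hN : 1 ≤ N) : numSlots N k ≤ N * (8 * k).size :=
  Nat.sInf_le (le_one_add_pow N k hN)

theorem one_le_numSlots {N k : ℕ} (hN : 1 ≤ N) (hk : 1 ≤ k) : 1 ≤ numSlots N k := by
  by_contra h
  have h1 := le_pow_numSlots (k := k) hN
  obtain h0 : numSlots N k = 0 := by omega
  rw [h0, pow_zero] at h1
  have : (1 : ℝ) ≤ k := by exact_mod_cast hk
  linarith

theorem initProg_triple {f : Finset V → ℝ} (hf0 : ∀ S, 0 ≤ f S) {N k m L : ℕ} (hN : 1 ≤ N)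
    (hm : 1 ≤ m) (hk : 1 ≤ k) (hL : numSlots N k = L) {μ : Mem V} (hI : Within (limits k m L) μ)
    (h0 : μ.nat 0 = k) (h1 : μ.nat 1 = 0) (hr : ∀ a, μ.real a = 0) (he : ∀ a, μ.elem a = 0) :
    Triple f (Within (limits k m L)) (initProg N) μ (L * 4 + 3)
      (StreamInv f k m L (1 + 1 / N) ∅) := by
  have hN0 : (0 : ℝ) < N := by exact_mod_cast hN
  have hLD : L ≤ L * m * k := by
    rw [mul_assoc]; exact Nat.le_mul_of_pos_right _ (Nat.mul_pos hm hk)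
  refine Triple.step hI (Triple.setReal hI (by simp only [NExp.ev, limits]; omega) rfl) (by omega)
    fun hI => ?_
  refine Triple.mono (Triple.forLoop (T := 3) L
    (fun l μ' => μ'.nat 0 = k ∧ μ'.nat 1 = l ∧ μ'.real 2 = (1 + 1 / N) ^ l ∧
      (∀ a, a ≠ 2 → μ'.real a = 0) ∧ ∀ a, μ'.elem a = 0) ?_ ?_ hI ?_) (by omega) ?_
  · rintro l μ' hl ⟨h0, -, h2, -⟩
    simp only [Test.ev, RExp.ev, NExp.ev, h0, h2]
    constructor
    · intro h
      refine lt_of_le_of_ne hl ?_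
      rintro rfl
      rw [← hL] at h
      exact h (by exact_mod_cast le_pow_numSlots (k := k) hN)
    · intro h h'
      rw [← hL] at h
      exact Nat.notMem_of_lt_sInf h (by exact_mod_cast h')
  · rintro l hl μ' hI ⟨h0, h1, h2, hr, he⟩
    refine Triple.step hI (Triple.setReal hI (by simp only [NExp.ev, limits]; omega) rfl) (by omega)
      fun hI => ?_
    refine Triple.leaf (Triple.setNat hI (by simp [NExp.ev, limits]) ?_ ?_) (by omega)
    · simp only [NExp.ev, h1]
      exact le_trans (by omega) (add_two_le_natValue k m L)
    · refine ⟨by simpa [NExp.ev] using h0, by simp [NExp.ev, h1], ?_, fun a ha => ?_, he⟩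
      · simp only [NExp.ev, RExp.ev, Function.update_self, h2, pow_succ]
        push_cast
        field_simp
      · simp [NExp.ev, ha, hr a ha]
  · refine ⟨h0, h1, by simp [NExp.ev, RExp.ev], fun a ha => ?_, he⟩
    simp [NExp.ev, ha, hr a]
  · rintro μ' - ⟨h0, h1, h2, hr, he⟩
    refine ⟨h0, h1, h2, by simp, Or.inl (hr 0 (by omega)), Or.inl ⟨hr 0 (by omega), fun j _ =>
      hr _ (by omega)⟩, fun j _ => SlotMem.restart hf0 (by simp) fun a _ _ => he a⟩

/-! ### Exhaustive search -/

/-- The number of the first `n` binary digits of `c` that are `1`. -/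
def digitCount (c n : ℕ) : ℕ := ((Finset.range n).filter fun r => c / 2 ^ r % 2 = 1).card

/-- The set of the elements in those of the cells `1, …, n` that `c` selects by its binary digits. -/
def selection (E : ℕ → WithZero V) (c n : ℕ) : Finset V :=
  (Finset.range n).biUnion fun r => if c / 2 ^ r % 2 = 1 then cellSet (E (1 + r)) else ∅

theorem selection_succ (E : ℕ → WithZero V) (c n : ℕ) : selection E c (n + 1) =
    selection E c n ∪ if c / 2 ^ n % 2 = 1 then cellSet (E (1 + n)) else ∅ := by
  rw [selection, Finset.range_add_one, Finset.biUnion_insert, Finset.union_comm]; rfl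

theorem selection_zero (E : ℕ → WithZero V) (n : ℕ) : selection E 0 n = ∅ := by
  ext v
  simp [selection]

theorem digitCount_succ (c n : ℕ) :
    digitCount c (n + 1) = digitCount c n + if c / 2 ^ n % 2 = 1 then 1 else 0 := by
  rw [digitCount, Finset.range_add_one, Finset.filter_insert]
  split_ifs
  · rw [Finset.card_insert_of_notMem (by simp)]; rfl
  · rfl

theorem digitCount_le (c n : ℕ) : digitCount c n ≤ n :=
  (Finset.card_filter_le _ _).trans (by simp)

theorem card_selection_le (E : ℕ → WithZero V) (c n : ℕ) :
    (selection E c n).card ≤ digitCount c n := by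
  induction n with
  | zero => simp [selection]
  | succ n ih =>
    rw [selection_succ, digitCount_succ]
    refine (Finset.card_union_le _ _).trans ?_
    split_ifs
    · have := card_cellSet_le (E (1 + n)); omega
    · simpa using ih

/-- An element may be stored in several slots; selecting one cell for each element of `S` keeps the
number of selected cells at most `S.card`. -/
theorem exists_selection_eq (E : ℕ → WithZero V) (n : ℕ) (S : Finset V) (hS : S ⊆ cells E 1 n) :
    ∃ c < 2 ^ n, selection E c n = S ∧ digitCount c n ≤ S.card := by
  have h : ∀ v, ∃ r, v ∈ S → r < n ∧ E (1 + r) = v := by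
    intro v
    by_cases hv : v ∈ S
    · obtain ⟨r, hr⟩ := mem_cells.1 (hS hv)
      exact ⟨r, fun _ => hr⟩
    · exact ⟨0, fun h => absurd h hv⟩
  choose g hg using h
  refine ⟨Nat.ofBits fun r : Fin n => decide ((r : ℕ) ∈ S.image g), Nat.ofBits_lt_two_pow _, ?_⟩
  have hbit : ∀ r < n, Nat.ofBits (fun r : Fin n => decide ((r : ℕ) ∈ S.image g)) / 2 ^ r % 2 = 1 ↔
      r ∈ S.image g := by
    intro r hr
    have h1 := Nat.testBit_ofBits_lt (fun r : Fin n => decide ((r : ℕ) ∈ S.image g)) r hr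
    rw [Nat.testBit_eq_decide_div_mod_eq] at h1
    simpa using h1
  generalize Nat.ofBits (fun r : Fin n => decide ((r : ℕ) ∈ S.image g)) = c at hbit
  constructor
  · ext v
    simp only [selection, Finset.mem_biUnion, Finset.mem_range]
    constructor
    · rintro ⟨r, hr, hv⟩
      split_ifs at hv with hc
      · obtain ⟨u, hu, rfl⟩ := Finset.mem_image.1 ((hbit r hr).1 hc)
        rw [mem_cellSet, (hg u hu).2, WithZero.coe_inj] at hv
        exact hv ▸ hu
      · simp at hv
    · intro hv
      refine ⟨g v, (hg v hv).1, ?_⟩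
      rw [if_pos ((hbit _ (hg v hv).1).2 (Finset.mem_image_of_mem g hv)), mem_cellSet]
      exact (hg v hv).2
  · refine (Finset.card_le_card fun r hr => ?_).trans (Finset.card_image_le (s := S) (f := g))
    rw [Finset.mem_filter, Finset.mem_range] at hr
    exact (hbit r hr.1).1 hr.2

/-- Fill the set buffer with the cells selected by the binary digits of cell `3`, and count them in
cell `5`. The number of the cells is in cell `8`. -/
def selectProg : Prog :=
  .seq .clearBuf <| .seq (.setNat (.const 5) (.const 0)) <| .seq (.setNat (.const 4) (.const 0)) <|
  .loop (.natLt (nvar 4) (nvar 8)) <|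
    .seq (.ite (.natEq (.mod (nvar 3) (.const 2)) (.const 1))
      (.seq (.addBuf (.add (.const 1) (nvar 4))) (.setNat (.const 5) (.add (nvar 5) (.const 1))))
      .skip) <|
    .seq (.setNat (.const 3) (.div (nvar 3) (.const 2)))
      (.setNat (.const 4) (.add (nvar 4) (.const 1)))

/-- Find a best set of at most `k` stored elements: cell `2` runs through all the selections, cell
`6` is the best one so far, and the real number cell `4` is its value. -/
def finishProg (m : ℕ) : Prog :=
  .seq (.setNat (.const 8) (.mul (.mul (nvar 1) (.const m)) (nvar 0))) <|
  .seq (.setNat (.const 7) (.const 1)) <| .seq (.setNat (.const 4) (.const 0)) <|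
  .seq (.loop (.natLt (nvar 4) (nvar 8)) <|
    .seq (.setNat (.const 7) (.mul (.const 2) (nvar 7)))
      (.setNat (.const 4) (.add (nvar 4) (.const 1)))) <|
  .seq .clearBuf <| .seq (.query (.const 4)) <|
  .seq (.setNat (.const 2) (.const 0)) <| .seq (.setNat (.const 6) (.const 0)) <|
  .seq (.loop (.natLt (nvar 2) (nvar 7)) <|
    .seq (.setNat (.const 3) (nvar 2)) <| .seq selectProg <|
    .seq (.ite (.natLt (nvar 0) (nvar 5)) .skip
      (.seq (.query (.const 5)) <| .ite (.realLe (rvar 5) (rvar 4)) .skip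
        (.seq (.setReal (.const 4) (rvar 5)) (.setNat (.const 6) (nvar 2)))))
      (.setNat (.const 2) (.add (nvar 2) (.const 1)))) <|
  .seq (.setNat (.const 3) (nvar 6)) selectProg

section Finish

variable {f : Finset V → ℝ} {k m L : ℕ} {μ : Mem V}

theorem selectProg_triple {c D : ℕ} (hD : L * m * k = D) (hI : Within (limits k m L) μ)
    (h8 : μ.nat 8 = D) (h3 : μ.nat 3 = c) :
    Triple f (Within (limits k m L)) selectProg μ (D * 10 + 7) fun μ' =>
      (∀ a ∉ ({3, 4, 5} : Finset ℕ), μ'.nat a = μ.nat a) ∧ μ'.real = μ.real ∧ μ'.elem = μ.elem ∧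
      μ'.buf = selection μ.elem c D ∧ μ'.nat 5 = digitCount c D := by
  have hV : D + 2 ≤ (limits k m L).natValue := hD ▸ add_two_le_natValue k m L
  refine Triple.step hI (Triple.clearBuf hI rfl) (by omega) fun hI => ?_
  refine Triple.step hI (Triple.setNat hI (by simp [NExp.ev, limits]) (by simp [NExp.ev]) rfl)
    (by omega) fun hI => ?_
  refine Triple.step hI (Triple.setNat hI (by simp [NExp.ev, limits]) (by simp [NExp.ev]) rfl)
    (by omega) fun hI => ?_
  refine Triple.mono (Triple.forLoop (T := 9) D
    (fun r μ' => (∀ a ∉ ({3, 4, 5} : Finset ℕ), μ'.nat a = μ.nat a) ∧ μ'.real = μ.real ∧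
      μ'.elem = μ.elem ∧ μ'.nat 3 = c / 2 ^ r ∧ μ'.nat 4 = r ∧
      μ'.buf = selection μ.elem c r ∧ μ'.nat 5 = digitCount c r) ?_ ?_ hI ?_) (by omega) ?_
  · rintro r μ' hr ⟨hn, -, -, -, h4, -⟩
    simp [Test.ev, NExp.ev, h4, hn 8 (by decide), h8]
  · rintro r hr μ₁ hI ⟨hn, hre, hel, h3, h4, hbuf, h5⟩
    refine Triple.seq (T := 4) (R := fun μ' => (∀ a ∉ ({3, 4, 5} : Finset ℕ), μ'.nat a = μ.nat a) ∧
      μ'.real = μ.real ∧ μ'.elem = μ.elem ∧ μ'.nat 3 = c / 2 ^ r ∧ μ'.nat 4 = r ∧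
      μ'.buf = selection μ.elem c (r + 1) ∧ μ'.nat 5 = digitCount c (r + 1)) hI ?_ (by omega) ?_
    · refine Triple.ite hI (by omega) (fun hb => ?_) (fun hb => ?_)
      · simp only [Test.ev, NExp.ev, h3] at hb
        refine Triple.step hI (Triple.addBuf hI ?_ rfl) (by omega) fun hI => ?_
        · rw [hbuf]
          have h1 := card_selection_le μ.elem c r
          have h2 := digitCount_le c r
          simp only [limits, hD]
          omega
        refine Triple.leaf (Triple.setNat hI (by simp [NExp.ev, limits]) ?_ ?_) (by omega)
        · have h2 := digitCount_le c r
          simp only [NExp.ev, h5]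
          omega
        · refine ⟨fun a h => ?_, hre, hel, by simpa [NExp.ev] using h3, by simpa [NExp.ev] using h4,
            ?_, ?_⟩
          · have h' := h
            simp only [Finset.mem_insert, Finset.mem_singleton, not_or] at h'
            simpa [NExp.ev, h'] using hn a h
          · simp [NExp.ev, selection_succ, hb, hbuf, hel, h4]
          · simp [NExp.ev, digitCount_succ, hb, h5]
      · simp only [Test.ev, NExp.ev, h3] at hb
        refine Triple.leaf (Triple.skip hI ?_) (by omega)
        exact ⟨hn, hre, hel, h3, h4, by simp [selection_succ, hb, hbuf],
          by simp [digitCount_succ, hb, h5]⟩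
    · rintro μ₂ hI ⟨hn, hre, hel, h3, h4, hbuf, h5⟩
      refine Triple.step hI (Triple.setNat hI (by simp [NExp.ev, limits]) ?_ rfl) (by omega)
        fun hI => ?_
      · simp only [NExp.ev]
        exact (Nat.div_le_self _ _).trans (hI.nat_le 3)
      refine Triple.leaf (Triple.setNat hI (by simp [NExp.ev, limits]) ?_ ?_) (by omega)
      · simp [NExp.ev, h4]; omega
      · refine ⟨fun a h => ?_, hre, hel, ?_, by simp [NExp.ev, h4], hbuf, by simpa [NExp.ev] using h5⟩
        · have h' := h
          simp only [Finset.mem_insert, Finset.mem_singleton, not_or] at h'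
          simpa [NExp.ev, h'] using hn a h
        · simp [NExp.ev, h3, Nat.div_div_eq_div_mul, pow_succ]
  · refine ⟨fun a h => ?_, rfl, rfl, by simpa [NExp.ev] using h3, by simp [NExp.ev],
      by simp [selection], by simp [NExp.ev, digitCount]⟩
    simp only [Finset.mem_insert, Finset.mem_singleton, not_or] at h
    simp [NExp.ev, h]
  · rintro μ' - ⟨hn, hre, hel, -, -, hbuf, h5⟩
    exact ⟨hn, hre, hel, hbuf, h5⟩

/-- A bound for the time of the exhaustive search over the contents of `D` cells. -/
def finishTime (D : ℕ) : ℕ := D * 4 + 2 ^ D * (D * 10 + 19 + 1) + D * 10 + 29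

theorem finishProg_triple {D : ℕ} (hD : L * m * k = D) (hI : Within (limits k m L) μ)
    (h0 : μ.nat 0 = k) (h1 : μ.nat 1 = L) :
    Triple f (Within (limits k m L)) (finishProg m) μ (finishTime D) fun μ' =>
      μ'.buf.card ≤ k ∧ ∀ S ⊆ cells μ.elem 1 D, S.card ≤ k → f S ≤ f μ'.buf := by
  have hV : 2 ^ D + D + 2 = (limits k m L).natValue := by simp only [limits, hD]
  have hpos := Nat.two_pow_pos D
  rw [finishTime]
  refine Triple.step hI (Triple.setNat hI (by simp [NExp.ev, limits]) ?_ rfl) (by omega)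
    fun hI => ?_
  · simp only [NExp.ev, h0, h1, hD]; omega
  refine Triple.step hI (Triple.setNat hI (by simp [NExp.ev, limits])
    (by simp only [NExp.ev]; omega) rfl) (by omega) fun hI => ?_
  refine Triple.step hI (Triple.setNat hI (by simp [NExp.ev, limits]) (by simp [NExp.ev]) rfl)
    (by omega) fun hI => ?_
  refine Triple.seq hI (Triple.forLoop (T := 3) D
    (fun r μ' => μ'.nat 0 = k ∧ μ'.nat 8 = D ∧ μ'.nat 4 = r ∧ μ'.nat 7 = 2 ^ r ∧
      μ'.elem = μ.elem) ?_ ?_ hI ?_) (by omega) ?_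
  · rintro r μ' hr ⟨-, h8, h4, -⟩
    simp [Test.ev, NExp.ev, h4, h8]
  · rintro r hr μ' hI ⟨h0, h8, h4, h7, hel⟩
    have hpow : 2 ^ (r + 1) ≤ 2 ^ D := Nat.pow_le_pow_right (by norm_num) hr
    refine Triple.step hI (Triple.setNat hI (by simp [NExp.ev, limits]) ?_ rfl) (by omega)
      fun hI => ?_
    · simp only [NExp.ev, h7]
      rw [pow_succ] at hpow
      omega
    refine Triple.leaf (Triple.setNat hI (by simp [NExp.ev, limits]) ?_ ?_) (by omega)
    · simp [NExp.ev, h4]; omega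
    · exact ⟨by simpa [NExp.ev] using h0, by simpa [NExp.ev] using h8, by simp [NExp.ev, h4],
        by simp [NExp.ev, h7, pow_succ, mul_comm], hel⟩
  · exact ⟨by simpa [NExp.ev] using h0, by simp [NExp.ev, h0, h1, hD], by simp [NExp.ev],
      by simp [NExp.ev], rfl⟩
  rintro μ₁ hI ⟨h0, h8, -, h7, hel⟩
  refine Triple.step hI (Triple.clearBuf hI rfl) (by omega) fun hI => ?_
  refine Triple.step hI (Triple.query hI (by simp only [NExp.ev, limits]; omega) rfl) (by omega)
    fun hI => ?_
  refine Triple.step hI (Triple.setNat hI (by simp [NExp.ev, limits]) (by simp [NExp.ev]) rfl)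
    (by omega) fun hI => ?_
  refine Triple.step hI (Triple.setNat hI (by simp [NExp.ev, limits]) (by simp [NExp.ev]) rfl)
    (by omega) fun hI => ?_
  refine Triple.seq hI (Triple.forLoop (T := D * 10 + 19) (2 ^ D)
    (fun c μ' => μ'.nat 0 = k ∧ μ'.nat 8 = D ∧ μ'.nat 7 = 2 ^ D ∧ μ'.nat 2 = c ∧
      μ'.elem = μ.elem ∧ μ'.real 4 = f (selection μ.elem (μ'.nat 6) D) ∧
      digitCount (μ'.nat 6) D ≤ k ∧ ∀ c' < c, digitCount c' D ≤ k →
        f (selection μ.elem c' D) ≤ μ'.real 4) ?_ ?_ hI ?_) (by omega) ?_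
  · rintro c μ' hc ⟨-, -, h7, h2, -⟩
    simp [Test.ev, NExp.ev, h2, h7]
  · rintro c hc μ₂ hI ⟨h0, h8, h7, h2, hel, h4, h6, hbest⟩
    refine Triple.step hI (Triple.setNat hI (by simp [NExp.ev, limits])
      (by simp only [NExp.ev]; exact hI.nat_le 2) rfl) (by omega) fun hI => ?_
    refine Triple.seq hI (selectProg_triple hD hI (by simpa [NExp.ev] using h8)
      (by simpa [NExp.ev] using h2)) (by omega) ?_
    rintro μ₃ hI ⟨hn, hre, hel', hbuf, h5⟩
    simp only [hel] at hel' hbuf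
    have hn' : ∀ a ∉ ({3, 4, 5} : Finset ℕ), μ₃.nat a = μ₂.nat a := by
      intro a h
      have h' := h
      simp only [Finset.mem_insert, Finset.mem_singleton, not_or] at h'
      simpa [NExp.ev, h'] using hn a h
    have h0' : μ₃.nat 0 = k := by rw [hn' 0 (by decide), h0]
    have h8' : μ₃.nat 8 = D := by rw [hn' 8 (by decide), h8]
    have h7' : μ₃.nat 7 = 2 ^ D := by rw [hn' 7 (by decide), h7]
    have h2' : μ₃.nat 2 = c := by rw [hn' 2 (by decide), h2]
    have h6' : μ₃.nat 6 = μ₂.nat 6 := hn' 6 (by decide)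
    refine Triple.seq (T := 7) (R := fun μ' => μ'.nat 0 = k ∧ μ'.nat 8 = D ∧ μ'.nat 7 = 2 ^ D ∧
      μ'.nat 2 = c ∧ μ'.elem = μ.elem ∧ μ'.real 4 = f (selection μ.elem (μ'.nat 6) D) ∧
      digitCount (μ'.nat 6) D ≤ k ∧ ∀ c' < c + 1, digitCount c' D ≤ k →
        f (selection μ.elem c' D) ≤ μ'.real 4) hI ?_ (by omega) ?_
    · refine Triple.ite hI (by omega) (fun hb => ?_) (fun hb => ?_)
      · simp only [Test.ev, NExp.ev, h0', h5] at hb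
        refine Triple.leaf (Triple.skip hI ⟨h0', h8', h7', h2', hel', by rw [hre, h6', h4],
          by rw [h6']; exact h6, fun c' hc' hk => ?_⟩) (by omega)
        rcases Nat.lt_succ_iff_lt_or_eq.1 hc' with h | rfl
        · rw [hre]; exact hbest c' h hk
        · omega
      · simp only [Test.ev, NExp.ev, h0', h5, not_lt] at hb
        refine Triple.step hI (Triple.query hI (by simp only [NExp.ev, limits]; omega) rfl)
          (by omega) fun hI => ?_
        refine Triple.ite hI (by omega) (fun hb' => ?_) (fun hb' => ?_)
        · simp only [Test.ev, RExp.ev, NExp.ev, Function.update_self,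
            Function.update_of_ne (show (4 : ℕ) ≠ 5 by decide), hre, hbuf] at hb'
          refine Triple.leaf (Triple.skip hI ⟨h0', h8', h7', h2', hel', ?_, ?_, ?_⟩) (by omega)
          · simp [NExp.ev, hre, h6', h4]
          · simp only [h6']; exact h6
          · intro c' hc' hk
            simp only [NExp.ev, Function.update_of_ne (show (4 : ℕ) ≠ 5 by decide), hre]
            rcases Nat.lt_succ_iff_lt_or_eq.1 hc' with h | rfl
            · exact hbest c' h hk
            · exact hb'
        · simp only [Test.ev, RExp.ev, NExp.ev, Function.update_self,
            Function.update_of_ne (show (4 : ℕ) ≠ 5 by decide), hre, hbuf, not_le] at hb'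
          refine Triple.step hI (Triple.setReal hI (by simp only [NExp.ev, limits]; omega) rfl)
            (by omega) fun hI => ?_
          refine Triple.leaf (Triple.setNat hI (by simp [NExp.ev, limits])
            (by simp only [NExp.ev]; exact hI.nat_le 2) ?_) (by omega)
          refine ⟨by simpa [NExp.ev] using h0', by simpa [NExp.ev] using h8',
            by simpa [NExp.ev] using h7', by simpa [NExp.ev] using h2', hel', ?_, ?_, ?_⟩
          · simp [NExp.ev, RExp.ev, hbuf, h2']
          · simpa [NExp.ev, h2'] using hb
          · intro c' hc' hk
            simp only [NExp.ev, RExp.ev, Function.update_self, hbuf]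
            rcases Nat.lt_succ_iff_lt_or_eq.1 hc' with h | rfl
            · exact (hbest c' h hk).trans hb'.le
            · exact le_rfl
    · rintro μ₄ hI ⟨h0, h8, h7, h2, hel, h4, h6, hbest⟩
      refine Triple.leaf (Triple.setNat hI (by simp [NExp.ev, limits]) ?_ ?_) (by omega)
      · simp [NExp.ev, h2]; omega
      · exact ⟨by simpa [NExp.ev] using h0, by simpa [NExp.ev] using h8,
          by simpa [NExp.ev] using h7, by simp [NExp.ev, h2], hel, by simpa [NExp.ev] using h4,
          by simpa [NExp.ev] using h6, hbest⟩
  · refine ⟨by simpa [NExp.ev] using h0, by simpa [NExp.ev] using h8, by simpa [NExp.ev] using h7,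
      by simp [NExp.ev], hel, by simp [NExp.ev, selection_zero], by simp [NExp.ev, digitCount],
      fun c' hc' => by omega⟩
  rintro μ₂ hI ⟨h0, h8, h7, h2, hel, h4, h6, hbest⟩
  refine Triple.step hI (Triple.setNat hI (by simp [NExp.ev, limits])
    (by simp only [NExp.ev]; exact hI.nat_le 6) rfl) (by omega) fun hI => ?_
  refine Triple.mono (selectProg_triple hD hI (by simpa [NExp.ev] using h8) rfl) (by omega) ?_
  rintro μ₃ - ⟨-, -, -, hbuf, -⟩
  simp only [NExp.ev, Function.update_self, hel] at hbuf
  refine ⟨?_, fun S hS hk => ?_⟩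
  · rw [hbuf]; exact (card_selection_le _ _ _).trans h6
  · obtain ⟨c, hc, rfl, hcard⟩ := exists_selection_eq μ.elem D S hS
    rw [hbuf, ← h4]
    exact hbest c hc (hcard.trans hk)

end Finish

/-! ### The quality of the stored elements -/

theorem StreamInv.le_mul [Fintype V] {f : Finset V → ℝ} (hf : IsSubmodular f)
    (h0 : ∀ S, 0 ≤ f S) {k m L : ℕ} {q ε a : ℝ} {μ : Mem V} (hε : 0 < ε) (hε1 : ε ≤ 1)
    (hk : 1 ≤ k) (hm : 8 ≤ m * ε) (hq : 1 < q) (hq' : q ≤ 1 + ε / 2) (hL : 8 * k ≤ q ^ L)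
    (h : StreamInv f k m L q Finset.univ μ)
    (ha : ∀ S ⊆ cells μ.elem 1 (L * m * k), S.card ≤ k → f S ≤ a) {S : Finset V}
    (hS : S.card ≤ k) : f S ≤ (3 + ε) * a := by
  have hk1 : (1 : ℝ) ≤ k := by exact_mod_cast hk
  obtain ⟨O, hO, hmax⟩ := Finset.exists_max_image
    (Finset.univ.filter fun S : Finset V => S.card ≤ k) f ⟨∅, by simp⟩
  simp only [Finset.mem_filter, Finset.mem_univ, true_and] at hO hmax
  refine (hmax S hS).trans ?_
  have ha0 : f ∅ ≤ a := ha ∅ (by simp) (by simp)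
  have ha1 : 0 ≤ a := (h0 ∅).trans ha0
  rcases O.eq_empty_or_nonempty with rfl | hne
  · nlinarith
  have hOM : f O ≤ k * μ.real 0 := by
    refine (hf.le_card_mul h0 (fun u _ => h.singleton_le u (Finset.mem_univ u)) hne).trans ?_
    have : (O.card : ℝ) ≤ k := by exact_mod_cast hO
    exact mul_le_mul_of_nonneg_right this h.thresholds.nonneg
  rcases h.thresholds.nonneg.eq_or_lt with hM | hM
  · rw [← hM, mul_zero] at hOM
    nlinarith
  have hMO : μ.real 0 ≤ f O := by
    rcases h.exists_singleton with h | ⟨u, -, h⟩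
    · exact absurd h hM.ne'
    · rw [← h]; exact hmax {u} (by simpa using hk)
  have hO0 : 0 < f O := hM.trans_le hMO
  have hden : 0 < (3 + ε) * k := by positivity
  -- the threshold `y / q < T ≤ y` is what the analysis of a slot asks for
  obtain ⟨j, hj, hj1, hj2⟩ := h.thresholds.exists_threshold
    (y := (1 + ε / 2) * f O / ((3 + ε) * k)) (by linarith)
    (by linarith) hM
    (by
      rw [div_le_iff₀ hden]
      calc (1 + ε / 2) * f O ≤ (1 + ε / 2) * (k * μ.real 0) := by gcongr
        _ ≤ (3 + ε) * (k * μ.real 0) := by gcongr <;> linarith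
        _ = μ.real 0 * ((3 + ε) * k) := by ring)
    (by
      have hy : f O / (3 * k) ≤ (1 + ε / 2) * f O / ((3 + ε) * k) := by
        rw [div_le_div_iff₀ (by positivity) hden]
        nlinarith [mul_pos hO0 (by linarith : (0 : ℝ) < k)]
      calc q * μ.real 0 ≤ 2 * f O := by nlinarith
        _ ≤ f O / (3 * k) * (8 * k) := by field_simp; norm_num
        _ ≤ (1 + ε / 2) * f O / ((3 + ε) * k) * q ^ L := by gcongr)
  rw [le_div_iff₀ hden] at hj1
  rw [div_lt_iff₀ hden] at hj2
  have hTpos : 0 < μ.real (6 + j) := by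
    by_contra hc
    have : q * μ.real (6 + j) * ((3 + ε) * k) ≤ 0 :=
      mul_nonpos_of_nonpos_of_nonneg (mul_nonpos_of_nonneg_of_nonpos (by linarith) (not_lt.1 hc))
        hden.le
    nlinarith
  obtain ⟨hslot, -⟩ := h.slotMem j hj
  refine hslot.le_mul hf h0 hε hε1 hm (Finset.subset_univ _) hO
    (fun i _ => card_cells_le _ _ _) hTpos.le ?_ (by linarith) fun S hS hSk => ha S ?_ hSk
  · have h1 : q * μ.real (6 + j) * ((3 + ε) * k) ≤
        (1 + ε / 2) * μ.real (6 + j) * ((3 + ε) * k) := by gcongr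
    have h2 : (1 + ε / 2) * f O ≤ (1 + ε / 2) * ((3 + ε) * (k * μ.real (6 + j))) := by linarith
    exact le_of_mul_le_mul_left h2 (by linarith)
  · refine hS.trans fun v hv => ?_
    obtain ⟨i, hi, hv⟩ := Finset.mem_biUnion.1 hv
    obtain ⟨r, hr, hv⟩ := mem_cells.1 hv
    have := addr_lt hj (Finset.mem_range.1 hi) hr
    exact mem_cells.2 ⟨(j * m + i) * k + r, by omega, by rw [← add_assoc]; exact hv⟩

/-! ### Complete runs -/

/-- The algorithm, with the ratio `1 + 1 / N` of thresholds and `m` bins for each threshold. -/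
def streamAlg (N m : ℕ) : Alg := ⟨initProg N, arrivalProg N m, finishProg m⟩

theorem arrivals_steps {f : Finset V → ℝ} (hf : IsSubmodular f) (hf0 : ∀ S, 0 ≤ f S)
    {N k m L : ℕ} (hN : 1 ≤ N) (hk : 1 ≤ k) (hm : 1 ≤ m) (hL : 1 ≤ L) (l : List V) :
    ∀ (P : Finset V) (μ : Mem V), Within (limits k m L) μ →
      StreamInv f k m L (1 + 1 / N) P μ → l.Nodup → (∀ v ∈ l, v ∉ P) →
      ∃ t ≤ l.length * (arrivalTime k m L + 1), ∃ μ', Within (limits k m L) μ' ∧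
        StreamInv f k m L (1 + 1 / N) (P ∪ l.toFinset) μ' ∧
        Steps (streamAlg N m) f (Within (limits k m L)) (μ, [], l, false) t
          (μ', [], [], false) := by
  induction l with
  | nil =>
    intro P μ hI h _ _
    exact ⟨0, by simp, μ, hI, by simpa using h, Steps.refl hI⟩
  | cons v l ih =>
    intro P μ hI h hnd hP
    set μ₁ : Mem V := ⟨μ.nat, μ.real, Function.update μ.elem 0 v, μ.buf⟩ with hμ₁
    have hI₁ : Within (limits k m L) μ₁ := by
      refine ⟨hI.nat_zero, hI.nat_le, hI.real_zero, fun a ha => ?_, hI.buf_le⟩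
      have : a ≠ 0 := by simp only [limits] at ha; omega
      exact (Function.update_of_ne this _ _).trans (hI.elem_zero a ha)
    have h₁ : StreamInv f k m L (1 + 1 / N) P μ₁ := by
      refine ⟨h.bound, h.slots, h.width, h.singleton_le, h.exists_singleton, h.thresholds,
        fun j hj => (h.slotMem j hj).congr fun a ha _ => ?_⟩
      exact Function.update_of_ne (by omega) _ _
    obtain ⟨t, ht, μ₂, hI₂, h₂, hs⟩ := arrivalProg_triple hf hf0 hN hk hm hL (hP v (by simp)) hI₁ h₁
      (by simp [hμ₁])
    rw [List.nodup_cons] at hnd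
    obtain ⟨t', ht', μ₃, hI₃, h₃, hs'⟩ := ih _ μ₂ hI₂ h₂ hnd.2 fun u hu hu' => by
      rcases Finset.mem_insert.1 hu' with rfl | hu'
      · exact hnd.1 hu
      · exact hP u (by simp [hu]) hu'
    refine ⟨1 + (t + t'), ?_, μ₃, hI₃, ?_, ?_⟩
    · rw [List.length_cons, Nat.succ_mul]; omega
    · rw [List.toFinset_cons, Finset.union_insert, ← Finset.insert_union]
      exact h₃
    · refine Steps.trans (Steps.single hI hI₁ ?_) (Steps.trans (hs _ _ _ _) hs')
      rintro ⟨n, r, el, bf, td, ip, en, co⟩ hc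
      simp only [Config.visible, Config.mem, Prod.mk.injEq] at hc
      obtain ⟨hc, rfl, rfl, rfl⟩ := hc
      simp only [hμ₁, ← hc]
      simp [Alg.step, Config.visible, Config.mem, streamAlg]

/-- A bound for the time of a run, for a ground set of `n` elements. -/
def runTime (k m L n : ℕ) : ℕ :=
  L * 4 + 3 + n * (arrivalTime k m L + 1) + 1 + finishTime (L * m * k)

/-- All the runs of the algorithm on an instance go the same way: they end in the same memory, which
does not depend on the coins, with a feasible set in the buffer that is best possible up to the
factor `3 + ε`, and the memory bounds hold all the time. -/
theorem exists_final [Fintype V] {f : Finset V → ℝ} {k : ℕ} {stream : List V}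
    (h : IsInstance f k stream) {N m : ℕ} (hN : 1 ≤ N) (hm : 1 ≤ m) {ε : ℝ} (hε : 0 < ε)
    (hε1 : ε ≤ 1) (hmε : 8 ≤ m * ε) (hNε : (1 : ℝ) / N ≤ ε / 2) :
    ∃ t ≤ runTime k m (numSlots N k) (Fintype.card V), ∃ B : Finset V, B.card ≤ k ∧
      (∀ S : Finset V, S.card ≤ k → f S ≤ (3 + ε) * f B) ∧
      ∀ ω, ((streamAlg N m).run f k stream ω t).Halted ∧
        ((streamAlg N m).run f k stream ω t).buf = B ∧
        ∀ s ≤ t, Within (limits k m (numSlots N k)) ((streamAlg N m).run f k stream ω s).mem := by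
  obtain ⟨hf0, hf, hk, hnd, hall⟩ := h
  have hN0 : (0 : ℝ) < N := by exact_mod_cast hN
  have hL := one_le_numSlots hN hk
  obtain ⟨L, hLdef⟩ : ∃ L, L = numSlots N k := ⟨_, rfl⟩
  have hL8 : (8 * k : ℝ) ≤ (1 + 1 / N) ^ L := hLdef ▸ le_pow_numSlots hN
  rw [← hLdef] at hL ⊢
  have hkD : k ≤ L * m * k := Nat.le_mul_of_pos_left _ (Nat.mul_pos hL hm)
  set μ₀ : Mem V := ⟨Finsupp.single 0 k, fun _ => 0, fun _ => 0, ∅⟩ with hμ₀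
  have hI₀ : Within (limits k m L) μ₀ := by
    refine ⟨fun a ha => ?_, fun a => ?_, fun _ _ => rfl, fun _ _ => rfl, by simp [hμ₀]⟩
    · simp only [limits] at ha
      simp only [hμ₀]
      rw [Finsupp.single_eq_of_ne (by omega)]
    · have := add_two_le_natValue k m L
      simp only [hμ₀, Finsupp.single_apply]
      split_ifs <;> omega
  obtain ⟨t₁, ht₁, μ₁, hI₁, h₁, hs₁⟩ := initProg_triple (f := f) hf0 hN hm hk hLdef.symm hI₀
    (by simp [hμ₀]) (by simp [hμ₀]) (fun _ => rfl) (fun _ => rfl)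
  obtain ⟨t₂, ht₂, μ₂, hI₂, h₂, hs₂⟩ := arrivals_steps hf hf0 hN hk hm hL stream ∅ μ₁ hI₁ h₁ hnd
    (by simp)
  obtain ⟨t₃, ht₃, μ₃, hI₃, ⟨hcard, hbest⟩, hs₃⟩ := finishProg_triple (f := f) rfl hI₂ h₂.bound
    h₂.slots
  have huniv : ∅ ∪ stream.toFinset = Finset.univ := by
    ext v; simp [hall v]
  rw [huniv] at h₂
  have hlen : stream.length = Fintype.card V := by
    rw [← List.toFinset_card_of_nodup hnd, ← Finset.card_univ, ← huniv, Finset.empty_union]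
  have hend : Steps (streamAlg N m) f (Within (limits k m L)) (μ₂, [], [], false) 1
      (μ₂, [finishProg m], [], true) := by
    refine Steps.single hI₂ hI₂ ?_
    rintro ⟨n, r, el, bf, td, ip, en, co⟩ hc
    simp only [Config.visible, Config.mem, Prod.mk.injEq] at hc
    obtain ⟨rfl, rfl, rfl, rfl⟩ := hc
    rfl
  have hrun := (((hs₁ (streamAlg N m) [] stream false).trans hs₂).trans hend).trans
    (hs₃ (streamAlg N m) [] [] true)
  refine ⟨t₁ + t₂ + 1 + t₃, ?_, μ₃.buf, hcard, fun S hS => ?_, fun ω => ?_⟩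
  · rw [hlen] at ht₂
    rw [runTime]
    omega
  · exact h₂.le_mul hf hf0 hε hε1 hk hmε (by linarith [one_div_pos.2 hN0]) (by linarith) hL8 hbest hS
  · obtain ⟨hfin, hw⟩ := hrun ((streamAlg N m).start k stream ω) (by
      simp only [Config.visible, Config.mem, Alg.start, streamAlg, hμ₀, Prod.mk.injEq, and_true, Mem.mk.injEq,
        true_and]
      constructor <;> rfl)
    simp only [Config.visible, Prod.mk.injEq] at hfin
    exact ⟨⟨hfin.2.1, hfin.2.2.1, hfin.2.2.2⟩, congrArg Mem.buf hfin.1, hw⟩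

theorem Config.Halted.step_eq {A : Alg} {f : Finset V → ℝ} {c : Config V} (h : c.Halted) :
    A.step f c = c := by
  obtain ⟨n, r, el, bf, td, ip, en, co⟩ := c
  obtain ⟨h1, h2, h3⟩ := h
  simp only at h1 h2 h3
  subst h1 h2 h3
  rfl

theorem Alg.run_eq_of_halted {A : Alg} {f : Finset V → ℝ} {k : ℕ} {stream : List V} {ω : ℕ → Bool}
    {t s : ℕ} (h : (A.run f k stream ω t).Halted) (hts : t ≤ s) :
    A.run f k stream ω s = A.run f k stream ω t := by
  obtain ⟨d, rfl⟩ := Nat.exists_eq_add_of_le hts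
  rw [Alg.run, add_comm, Function.iterate_add_apply]
  exact Function.iterate_fixed h.step_eq d

theorem Alg.output_eq {A : Alg} {f : Finset V → ℝ} {k : ℕ} {stream : List V} {ω : ℕ → Bool}
    {t : ℕ} (h : (A.run f k stream ω t).Halted) :
    A.output f k stream ω = (A.run f k stream ω t).buf := by
  have hex : ∃ t, (A.run f k stream ω t).Halted := ⟨t, h⟩
  rw [Alg.output, dif_pos hex, run_eq_of_halted (Nat.find_spec hex) (Nat.find_min' hex h)]

theorem within_of_run {A : Alg} {f : Finset V → ℝ} {k : ℕ} {stream : List V} {ω : ℕ → Bool}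
    {w : Limits} {t : ℕ} (h : (A.run f k stream ω t).Halted)
    (hw : ∀ s ≤ t, Within w (A.run f k stream ω s).mem) (s : ℕ) :
    Within w (A.run f k stream ω s).mem := by
  rcases le_total s t with hst | hst
  · exact hw s hst
  · rw [Alg.run_eq_of_halted h hst]; exact hw t le_rfl

/-! ### Space -/

theorem Within.stored_le {w : Limits} {c : Config V} (h : Within w c.mem) :
    c.stored ≤ w.elemCells + w.bufSize := by
  have h1 : c.elem.support ⊆ Finset.range w.elemCells := by
    intro a ha
    by_contra hc
    exact Finsupp.mem_support_iff.1 ha (h.elem_zero a (by simpa using hc))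
  have h2 := Finset.card_le_card h1
  rw [Finset.card_range] at h2
  exact add_le_add h2 h.buf_le

theorem Within.space_le {w : Limits} {c : Config V} (h : Within w c.mem) :
    c.space ≤ w.natCells * (w.natCells.size + w.natValue.size) +
      w.realCells * (w.realCells.size + 1) + w.elemCells * (w.elemCells.size + 1) + w.bufSize := by
  have key : ∀ (s : Finset ℕ) (g : ℕ → ℕ) (n b : ℕ), s ⊆ Finset.range n →
      (∀ a ∈ Finset.range n, g a ≤ b) → ∑ a ∈ s, g a ≤ n * b := by
    intro s g n b hs hg
    refine (Finset.sum_le_sum_of_subset hs).trans ?_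
    simpa using Finset.sum_le_card_nsmul _ _ _ hg
  have hsize : ∀ {a n : ℕ}, a ∈ Finset.range n → a.size ≤ n.size := fun ha =>
    Nat.size_le_size (Finset.mem_range.1 ha).le
  refine add_le_add (add_le_add (add_le_add ?_ ?_) ?_) h.buf_le
  · refine key _ _ _ _ (fun a ha => ?_) fun a ha =>
      add_le_add (hsize ha) (Nat.size_le_size (h.nat_le a))
    by_contra hc
    exact Finsupp.mem_support_iff.1 ha (h.nat_zero a (by simpa using hc))
  · refine key _ _ _ _ (fun a ha => ?_) fun a ha => add_le_add (hsize ha) le_rfl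
    by_contra hc
    exact Finsupp.mem_support_iff.1 ha (h.real_zero a (by simpa using hc))
  · refine key _ _ _ _ (fun a ha => ?_) fun a ha => add_le_add (hsize ha) le_rfl
    by_contra hc
    exact Finsupp.mem_support_iff.1 ha (h.elem_zero a (by simpa using hc))

theorem size_mul_le (a b : ℕ) : (a * b).size ≤ a.size + b.size := by
  rw [Nat.size_le, pow_add]
  exact Nat.mul_lt_mul'' (Nat.lt_size_self a) (Nat.lt_size_self b)

theorem size_le_log {k : ℕ} (hk : 1 ≤ k) : (k.size : ℝ) ≤ 3 * Real.log (k + 1) := by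
  have hk1 : (1 : ℝ) ≤ k := by exact_mod_cast hk
  have hs : 1 ≤ k.size := Nat.size_pos.2 hk
  have h1 : 2 ^ (k.size - 1) ≤ k := by
    by_contra hc
    have := Nat.size_le.2 (not_le.1 hc)
    omega
  have h2 : ((2 : ℝ) ^ (k.size - 1)) ≤ k + 1 := by
    have : ((2 : ℝ) ^ (k.size - 1)) ≤ k := by exact_mod_cast h1
    linarith
  have h3 := Real.log_le_log (by positivity) h2
  rw [Real.log_pow, Nat.cast_sub hs, Nat.cast_one] at h3
  have h4 : Real.log 2 ≤ Real.log (k + 1) := Real.log_le_log (by norm_num) (by linarith)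
  have h5 := Real.log_two_gt_d9
  have h6 : (1 : ℝ) ≤ k.size := by exact_mod_cast hs
  nlinarith

theorem cellCount_le {N m k : ℕ} (hN : 1 ≤ N) (hk : 1 ≤ k) :
    numSlots N k * m * k ≤ 5 * (N * m) * (k * k.size) := by
  have h1 := numSlots_le (k := k) hN
  have h2 := size_mul_le 8 k
  have h3 : Nat.size 8 = 4 := by decide
  have hs : 1 ≤ k.size := Nat.size_pos.2 hk
  calc numSlots N k * m * k ≤ N * (5 * k.size) * m * k := by
        gcongr
        refine h1.trans ?_
        gcongr
        omega
    _ = 5 * (N * m) * (k * k.size) := by ring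

theorem one_le_cellCount {N m k : ℕ} (hN : 1 ≤ N) (hm : 1 ≤ m) (hk : 1 ≤ k) :
    1 ≤ numSlots N k * m * k :=
  Nat.mul_pos (Nat.mul_pos (one_le_numSlots hN hk) hm) hk

theorem size_cellCount_le {N m k : ℕ} (hN : 1 ≤ N) (hm : 1 ≤ m) (hk : 1 ≤ k) :
    (numSlots N k * m * k + 6).size ≤ ((35 * (N * m)).size + 2) * k.size := by
  have h1 := cellCount_le (m := m) hN hk
  have h2 := one_le_cellCount hN hm hk
  have hs : 1 ≤ k.size := Nat.size_pos.2 hk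
  have h3 : numSlots N k * m * k + 6 ≤ 35 * (N * m) * (k * k.size) := by
    calc numSlots N k * m * k + 6 ≤ 7 * (numSlots N k * m * k) := by omega
      _ ≤ 7 * (5 * (N * m) * (k * k.size)) := by gcongr
      _ = 35 * (N * m) * (k * k.size) := by ring
  have h4 := size_mul_le (35 * (N * m)) (k * k.size)
  have h5 := size_mul_le k k.size
  have h6 : k.size.size ≤ k.size := Nat.size_le.2 Nat.lt_two_pow_self
  have h7 := Nat.size_le_size h3
  have h8 : (35 * (N * m)).size ≤ (35 * (N * m)).size * k.size := Nat.le_mul_of_pos_right _ hs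
  rw [add_mul]
  omega

theorem space_le {N m k : ℕ} (hN : 1 ≤ N) (hm : 1 ≤ m) (hk : 1 ≤ k) {c : Config V}
    (h : Within (limits k m (numSlots N k)) c.mem) :
    c.space ≤ 460 * (N * m) * ((35 * (N * m)).size + 2) * (k * k.size ^ 2) := by
  have h1 := cellCount_le (m := m) hN hk
  have h2 := one_le_cellCount hN hm hk
  have h3 := size_cellCount_le hN hm hk
  have hL : numSlots N k ≤ numSlots N k * m * k := by
    rw [mul_assoc]; exact Nat.le_mul_of_pos_right _ (Nat.mul_pos hm hk)
  have hspace := h.space_le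
  simp only [limits] at hspace
  set L := numSlots N k
  set D := L * m * k
  have hv : (2 ^ D + D + 2).size ≤ D + 3 := by
    rw [Nat.size_le]
    have := Nat.lt_two_pow_self (n := D)
    have := Nat.one_le_two_pow (n := D)
    rw [pow_add]
    omega
  have h9 : Nat.size 9 = 4 := by decide
  have hr : (6 + L).size ≤ (D + 6).size := Nat.size_le_size (by omega)
  have he : (D + 1).size ≤ (D + 6).size := Nat.size_le_size (by omega)
  have hZ : 1 ≤ (D + 6).size := Nat.size_pos.2 (by omega)
  set Z := (D + 6).size
  have hDZ : D ≤ D * Z := Nat.le_mul_of_pos_right _ hZ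
  calc c.space ≤ 9 * (4 + (D + 3)) + (6 + D) * (Z + 1) + (D + 1) * (Z + 1) + (D + 1) := by
        refine hspace.trans ?_
        rw [h9]
        gcongr
    _ ≤ 92 * (D * Z) := by nlinarith
    _ ≤ 92 * ((5 * (N * m) * (k * k.size)) * (((35 * (N * m)).size + 2) * k.size)) := by gcongr
    _ = 460 * (N * m) * ((35 * (N * m)).size + 2) * (k * k.size ^ 2) := by ring

end Streaming
end

open Streaming in
theorem theorem1 :
    ∃ (C : ℝ) (d : ℕ), ∀ ε : ℝ, 0 < ε → ε ≤ 1 →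
      ∃ A : Streaming.Alg,
        A.IsApproximation (3 + ε) ∧
        A.IsSemiStreaming ∧
        A.StoresAtMost (fun k => C * (k * (ε ^ 2)⁻¹ * Real.log (k + 1))) ∧
        ∃ h : ℕ → ℝ, A.RunsInTime (fun k n => h k * ((n : ℝ) + 1) ^ d) := by
  -- `20 * 3 * 3 * 9 = 1620`, as at most `20 N m k * k.size` elements are stored, `N ≤ 3 / ε`,
  -- `m ≤ 9 / ε` and `k.size ≤ 3 log (k + 1)`
  refine ⟨1620, 1, fun ε hε hε1 => ?_⟩
  obtain ⟨N, hNdef⟩ : ∃ N, N = ⌈2 / ε⌉₊ := ⟨_, rfl⟩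
  obtain ⟨m, hmdef⟩ : ∃ m, m = ⌈8 / ε⌉₊ := ⟨_, rfl⟩
  have hN1 : 2 / ε ≤ N := hNdef ▸ Nat.le_ceil _
  have hm1 : 8 / ε ≤ m := hmdef ▸ Nat.le_ceil _
  have hinv : 1 ≤ 1 / ε := by rwa [le_div_iff₀ hε, one_mul]
  have hN2 : (N : ℝ) ≤ 3 / ε := by
    have := (Nat.ceil_lt_add_one (a := 2 / ε) (by positivity)).le
    rw [← hNdef] at this
    have e : 3 / ε = 2 / ε + 1 / ε := by ring
    linarith
  have hm2 : (m : ℝ) ≤ 9 / ε := by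
    have := (Nat.ceil_lt_add_one (a := 8 / ε) (by positivity)).le
    rw [← hmdef] at this
    have e : 9 / ε = 8 / ε + 1 / ε := by ring
    linarith
  have hN0 : (0 : ℝ) < N := lt_of_lt_of_le (by positivity) hN1
  have hm0 : (0 : ℝ) < m := lt_of_lt_of_le (by positivity) hm1
  have hN : 1 ≤ N := by exact_mod_cast hN0
  have hm : 1 ≤ m := by exact_mod_cast hm0
  have hmε : 8 ≤ m * ε := (div_le_iff₀ hε).1 hm1
  have hNε : (1 : ℝ) / N ≤ ε / 2 := by
    rw [div_le_iff₀ hε] at hN1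
    rw [div_le_iff₀ hN0]
    linarith
  have hfinal := fun (V : Type) (_ : Fintype V) (inst : DecidableEq V) (f : Finset V → ℝ) (k : ℕ)
      (stream : List V) (h : IsInstance f k stream) =>
    exists_final (V := V) (f := f) (k := k) (stream := stream)
      (by convert h) hN hm hε hε1 hmε hNε
  have hwithin : ∀ (V : Type) (_ : Fintype V) (inst : DecidableEq V) (f : Finset V → ℝ) (k : ℕ)
      (stream : List V), IsInstance f k stream → ∀ ω s, Within (limits k m (numSlots N k))
        ((streamAlg N m).run f k stream ω s).mem := by
    intro V _ _ f k stream h ω s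
    obtain ⟨t, -, B, -, -, hrun⟩ := hfinal V _ _ f k stream h
    obtain ⟨hhalt, -, hw⟩ := hrun ω
    exact within_of_run hhalt hw s
  have hlog : ∀ k : ℕ, 0 ≤ Real.log (k + 1) := fun k =>
    Real.log_nonneg (by linarith [Nat.cast_nonneg (α := ℝ) k])
  refine ⟨streamAlg N m, ?_, ⟨9 * (460 * (N * m) * ((35 * (N * m)).size + 2) : ℕ), 2, ?_⟩, ?_,
    fun k => runTime k m (numSlots N k) 1, ?_⟩
  · intro V _ _ f k stream h
    obtain ⟨t, -, B, hB, hbest, hrun⟩ := hfinal V _ _ f k stream h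
    have hout : ∀ ω, (streamAlg N m).output f k stream ω = B := fun ω => by
      rw [Alg.output_eq (hrun ω).1, (hrun ω).2.1]
    have : IsProbabilityMeasure coinLaw := by unfold coinLaw; infer_instance
    simp only [hout]
    refine ⟨fun ω => ⟨⟨t, (hrun ω).1⟩, hB⟩, integrable_const _, fun S hS => ?_⟩
    simpa using hbest S hS
  · intro V _ _ f k stream h ω s
    have hk := h.one_le
    have h1 := space_le hN hm hk (hwithin V _ _ f k stream h ω s)
    have h2 : (k.size : ℝ) ≤ 3 * Real.log (k + Fintype.card V + 1) := by
      refine (size_le_log hk).trans ?_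
      gcongr
      linarith [Nat.cast_nonneg (α := ℝ) (Fintype.card V)]
    set K := 460 * (N * m) * ((35 * (N * m)).size + 2)
    calc (((streamAlg N m).run f k stream ω s).space : ℝ) ≤ ((K * (k * k.size ^ 2) : ℕ) : ℝ) := by
          exact_mod_cast h1
      _ = K * (k * (k.size : ℝ) ^ 2) := by push_cast; ring
      _ ≤ K * (k * (3 * Real.log (k + Fintype.card V + 1)) ^ 2) := by gcongr
      _ = 9 * K * k * Real.log (k + Fintype.card V + 1) ^ 2 := by ring
  · intro V _ _ f k stream h ω s
    have hk := h.one_le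
    have h1 := (hwithin V _ _ f k stream h ω s).stored_le
    have h2 := cellCount_le (m := m) hN hk
    have h3 := one_le_cellCount hN hm hk
    simp only [limits] at h1
    have h4 : ((streamAlg N m).run f k stream ω s).stored ≤ 20 * (N * m) * (k * k.size) := by
      calc _ ≤ 4 * (5 * (N * m) * (k * k.size)) := by omega
        _ = _ := by ring
    calc (((streamAlg N m).run f k stream ω s).stored : ℝ)
        ≤ ((20 * (N * m) * (k * k.size) : ℕ) : ℝ) := by exact_mod_cast h4
      _ = 20 * (N * m) * (k * (k.size : ℝ)) := by push_cast; ring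
      _ ≤ 20 * (3 / ε * (9 / ε)) * (k * (3 * Real.log (k + 1))) := by
          gcongr
          exact size_le_log hk
      _ = 1620 * (k * (ε ^ 2)⁻¹ * Real.log (k + 1)) := by field_simp; ring
  · intro V _ _ f k stream h ω
    obtain ⟨t, ht, B, -, -, hrun⟩ := hfinal V _ _ f k stream h
    refine ⟨t, ?_, (hrun ω).1⟩
    have h1 : runTime k m (numSlots N k) (Fintype.card V) ≤
        runTime k m (numSlots N k) 1 * (Fintype.card V + 1) := by
      simp only [runTime]
      nlinarith [Nat.zero_le (Fintype.card V * (numSlots N k)),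
        Nat.zero_le (Fintype.card V * finishTime (numSlots N k * m * k)),
        Nat.zero_le (arrivalTime k m (numSlots N k))]
    simp only [pow_one]
    exact_mod_cast ht.trans h1
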